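/- Let $0<a<c$, $\Lambda\in\mathbb R$ and $\tilde\Lambda=\Lambda/(2\pi)$. Let $w(k)=\sqrt{(k^2+c^2)(k^2+a^2)}$ be the branch holomorphic on $\mathbb C\setminus([ic,ia]\cup[-ia,-ic])$ with $w(0)>0$, and let the two-sheeted surface of $w$ be glued along these cuts. Let the cycle $\mathbf a$ run from $ia$ to $-ia$ on the upper sheet and back from $-ia$ to $ia$ on the lower sheet, and let $\mathbf b$ surround $ia,ic$ counterclockwise on the upper sheet. Put $$\Gamma=\Big(\int_{\mathbf a}\frac{d\zeta}{w(\zeta)}\Big)^{-1},\qquad \tau=\Gamma\int_{\mathbf b}\frac{d\zeta}{w(\zeta)},\qquad A(k)=\Gamma\int_{ic}^{k}\frac{d\zeta}{w(\zeta)}\quad(k\in\mathbb C\setminus[ic,-ic]),$$ where the path from $ic$ to $k$ avoids the cut $[ic,-ic]$, except for its starting point. Let $\theta_3(z\,|\,\tau)=\sum_{n\in\mathbb Z}e^{(n^2\tau+2nz)\pi i}$, $$\alpha^{\Lambda}(k)=\theta_3\big(A(k)-\tfrac12-\tfrac{\tilde\Lambda}2\,\big|\,\tau\big)\,\theta_3\big(A(k)-\tfrac{\tilde\Lambda}2\,\big|\,\tau\big),\qquad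 \beta^{\Lambda}(k)=\theta_3\big(-A(k)-\tfrac12-\tfrac{\tilde\Lambda}2\,\big|\,\tau\big)\,\theta_3\big(-A(k)-\tfrac{\tilde\Lambda}2\,\big|\,\tau\big),$$ $\hat\alpha=\alpha^{\Lambda}/\alpha^{0}$, $\hat\beta=\beta^{\Lambda}/\beta^{0}$, and let $\hat\alpha(\infty),\hat\beta(\infty)$ be their limits as $k\to\infty$. Let $\tilde\gamma(k)=\sqrt[4]{(k^2+a^2)/(k^2+c^2)}$ be the branch holomorphic on $\mathbb C\setminus([ic,ia]\cup[-ia,-ic])$ with $\tilde\gamma(0)>0$. Finally let $$m^{\mathrm{mod}}(k)=\big(m^{\mathrm{mod}}_1(k),\,m^{\mathrm{mod}}_2(k)\big)=\Big(\tilde\gamma(k)\frac{\hat\alpha(k)}{\hat\alpha(\infty)},\ \tilde\gamma(k)\frac{\hat\beta(k)}{\hat\beta(\infty)}\Big)$$ be the model solution, and let $p=m^{\mathrm{mod}}_1m^{\mathrm{mod}}_2$. Then, with $\theta_3(\cdot)=\theta_3(\cdot\,|\,2\tau)$, for all $k\in\mathbb C\setminus[ic,-ic]$ $$p(k)=\tilde\gamma^2(k)\,\frac{\theta_3(2A(k)-\frac12-\tilde\Lambda)\,\theta_3(-2A(k)+\frac12-\tilde\Lambda)\,\theta_3(0)^2}{\theta_3(2A(k)-\frac12)^2\,\theta_3(\tilde\Lambda)^2}.$$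 Moreover, as $k\to\infty$ in $\mathbb C$, $$p(k)=1+\frac1{2k^2}\Big(8\Gamma^2\frac{d^2}{dv^2}\log\theta_3(v)\Big|_{v=\tilde\Lambda}+Q\Big)+O\Big(\frac1{k^4}\Big),\qquad Q=-a^2+c^2\Big(1-2\,\frac{E(a/c)}{K(a/c)}\Big),$$ where $K(s)=\int_0^{\pi/2}\frac{d\varphi}{\sqrt{1-s^2\sin^2\varphi}}$ and $E(s)=\int_0^{\pi/2}\sqrt{1-s^2\sin^2\varphi}\,d\varphi$ are the complete elliptic integrals with modulus $s$. -/

import Mathlib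

noncomputable section

namespace ModelRH

/-- Principal branch of the complex square root, with cut along the negative half-axis. -/
def csqrt (z : ℂ) : ℂ := z ^ (1 / 2 : ℂ)

/-- The cut `[ic, -ic]` in the complex plane. -/
def cut (c : ℝ) : Set ℂ := segment ℝ (Complex.I * c) (-(Complex.I * c))

/-- The branch of `√((k² + c²)(k² + a²))` which is holomorphic off `[ic, ia] ∪ [-ia, -ic]` and
positive at `k = 0`. On the open segment from `ia` to `ic` itself this formula returns the limit
from the right-hand side `Re k > 0`; the limit from the left-hand side is its negative. -/
def w (c a : ℝ) (k : ℂ) : ℂ :=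
  csqrt (k ^ 2 + (c : ℂ) ^ 2) * csqrt (k ^ 2 + (a : ℂ) ^ 2)

/-- The integral `∫ f(ζ) dζ` along the straight line segment from `z₁` to `z₂`. -/
def segInt (f : ℂ → ℂ) (z₁ z₂ : ℂ) : ℂ :=
  ∫ t in (0 : ℝ)..1, f (z₁ + (t : ℂ) * (z₂ - z₁)) * (z₂ - z₁)

/-- The period of `dζ / w` along the `a`-cycle, which runs from `ia` to `-ia` on the upper sheet
and returns from `-ia` to `ia` on the lower sheet, where `w` changes its sign. -/
def aPeriod (c a : ℝ) : ℂ :=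
  segInt (fun ζ => 1 / w c a ζ) (Complex.I * a) (-(Complex.I * a)) +
    segInt (fun ζ => 1 / -(w c a ζ)) (-(Complex.I * a)) (Complex.I * a)

/-- The period of `dζ / w` along the `b`-cycle, which surrounds `ia` and `ic` counterclockwise on
the upper sheet, contracted to the cut: it runs up from `ia` to `ic` along the right-hand side of
the cut and down from `ic` to `ia` along its left-hand side, where `w` has the opposite sign. -/
def bPeriod (c a : ℝ) : ℂ :=
  segInt (fun ζ => 1 / w c a ζ) (Complex.I * a) (Complex.I * c) +
    segInt (fun ζ => 1 / -(w c a ζ)) (Complex.I * c) (Complex.I * a)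

/-- The normalization constant: `dω = Γ dζ / w` has `a`-period `1`. -/
def Gam (c a : ℝ) : ℂ := (aPeriod c a)⁻¹

/-- The `b`-period of `dω`. -/
def tau (c a : ℝ) : ℂ := Gam c a * bPeriod c a

/-- The Jacobi theta function `θ₃(z | τ) = ∑ₙ exp((n² τ + 2 n z) π i)`. -/
def theta3 (z τ : ℂ) : ℂ := jacobiTheta₂ z τ

/-- The Abel map `A(k) = ∫_{ic}^k dω` on the upper sheet, for `k` off the cut `[ic, -ic]`. The path
must avoid the cut (its value does not depend on the path, since `1 / w(ζ) = O(ζ⁻²)` has no residue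
at infinity): we take the straight segment, or, for the points `k` below `-ic` on the imaginary
axis, whose segment would meet the cut, the broken line from `ic` through `c` to `k`. -/
def abel (c a : ℝ) (k : ℂ) : ℂ :=
  open scoped Classical in
  if k.re = 0 ∧ k.im < 0 then
    Gam c a * (segInt (fun ζ => 1 / w c a ζ) (Complex.I * c) c +
      segInt (fun ζ => 1 / w c a ζ) c k)
  else
    Gam c a * segInt (fun ζ => 1 / w c a ζ) (Complex.I * c) k

/-- `α^Λ(k)` with `L = Λ / (2π)`. -/
def alpha (c a L : ℝ) (k : ℂ) : ℂ :=
  theta3 (abel c a k - 1 / 2 - (L : ℂ) / 2) (tau c a) *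
    theta3 (abel c a k - (L : ℂ) / 2) (tau c a)

/-- `β^Λ(k)` with `L = Λ / (2π)`. -/
def beta (c a L : ℝ) (k : ℂ) : ℂ :=
  theta3 (-abel c a k - 1 / 2 - (L : ℂ) / 2) (tau c a) *
    theta3 (-abel c a k - (L : ℂ) / 2) (tau c a)

/-- `α^Λ(k) / α⁰(k)`. -/
def alphaHat (c a L : ℝ) (k : ℂ) : ℂ := alpha c a L k / alpha c a 0 k

/-- `β^Λ(k) / β⁰(k)`. -/
def betaHat (c a L : ℝ) (k : ℂ) : ℂ := beta c a L k / beta c a 0 k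

/-- The value `f(∞) = lim_{k → ∞} f(k)`. -/
def atInfty (f : ℂ → ℂ) : ℂ := Filter.limUnder (Bornology.cobounded ℂ) f

/-- The branch of `((k² + a²) / (k² + c²))^{1/4}` which is holomorphic off
`[ic, ia] ∪ [-ia, -ic]` and positive at `k = 0`. -/
def gammaTilde (c a : ℝ) (k : ℂ) : ℂ :=
  ((k ^ 2 + (a : ℂ) ^ 2) / (k ^ 2 + (c : ℂ) ^ 2)) ^ (1 / 4 : ℂ)

/-- First component of the model solution with jump parameter `Λ`. -/
def mMod₁ (c a Λ : ℝ) (k : ℂ) : ℂ :=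
  gammaTilde c a k * (alphaHat c a (Λ / (2 * Real.pi)) k /
    atInfty (alphaHat c a (Λ / (2 * Real.pi))))

/-- Second component of the model solution with jump parameter `Λ`. -/
def mMod₂ (c a Λ : ℝ) (k : ℂ) : ℂ :=
  gammaTilde c a k * (betaHat c a (Λ / (2 * Real.pi)) k /
    atInfty (betaHat c a (Λ / (2 * Real.pi))))

/-- Complete elliptic integral of the first kind with modulus `s`. -/
def ellK (s : ℝ) : ℝ := ∫ φ in (0 : ℝ)..(Real.pi / 2), 1 / Real.sqrt (1 - s ^ 2 * Real.sin φ ^ 2)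

/-- Complete elliptic integral of the second kind with modulus `s`. -/
def ellE (s : ℝ) : ℝ := ∫ φ in (0 : ℝ)..(Real.pi / 2), Real.sqrt (1 - s ^ 2 * Real.sin φ ^ 2)

/-- The constant `Q = -a² + c² (1 - 2 E(a/c) / K(a/c))`. -/
def Qconst (c a : ℝ) : ℝ := -a ^ 2 + c ^ 2 * (1 - 2 * (ellE (a / c) / ellK (a / c)))

end ModelRH

end

/-! Taking `w = z - 1/2` in the addition formula `theta_mul_theta` kills one of its two products,
because `θ₃(· | 2τ)` vanishes at `τ - 1/2`. Each of `α^Λ`, `β^Λ` is therefore a single theta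
function at `2τ` times the constant `θ₃(1/2 | 2τ)`, which cancels in `α̂` and `β̂` (`alphaHat_eq`,
`betaHat_eq`). Since `A(∞) = 1/4`, the normalising limits are both `θ₃(Λ̃) / θ₃(0)`, and the product
formula follows (`mMod_mul`).

For the expansion put `u = 1/k` and `δ = 2A(k) - 1/2`. By `abel_eq`, `δ = -2Γ F(u)` with `F =
abelInfty` odd and `F(u) = u + O(u³)`. By evenness of `θ₃`, the logarithm of `p` is `log γ̃²` plus
the second difference of `log θ₃` at `Λ̃` with step `δ`, minus the one at `0`. Second differences
have only even Taylor terms, so `log p = ((a² - c²)/2 + 4Γ²((log θ₃)''(Λ̃) - (log θ₃)''(0))) u² +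
O(u⁴)`, and exponentiating gives the result once `Q = a² - c² - 8Γ²(log θ₃)''(0)` is known.

The deep part is this value at `0`. The periods reduce to Legendre form: with `m = (a/c)²` and `K' =
K(1 - m)`, `Γ = ic/(4K)` and `2τ = iK'/K` (`Gam_eq`, `two_tau_eq`). As `θ₃` is even, `(log θ₃)''(0)
= θ₃''(0)/θ₃(0)`, which the heat equation turns into a derivative in the period ratio. That
derivative comes from differentiating the classical identity `θ₃(0 | iK'/K)² = 2K/π` in `m`;
Legendre's relation evaluates the derivative of `K'/K`.

The classical identity is proved through the arithmetic-geometric mean. Doubling `t` performs one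
AGM step on `(θ₃², θ₄²)` at `it`, Gauss's integral is invariant under the step (`gaussI_agm`), and
the iterates tend to `(1, 1)`. This gives `K(1 - θ₄⁴/θ₃⁴) = (π/2) θ₃²` for every `t`; Jacobi's
imaginary transformation, the quartic identity and injectivity of `K'/K` then express `t` through
`m`. -/

noncomputable section

open Filter Topology

namespace ModelRH

/-! ### Theta function identities -/

section Theta

open Complex
open scoped Real

/-- The bijection of `ℤ² ⊔ ℤ²` with `ℤ²` splitting pairs by the parity of their sum. -/
def paritySplit : (ℤ × ℤ) ⊕ (ℤ × ℤ) ≃ ℤ × ℤ where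
  toFun := Sum.elim (fun p => (p.1 + p.2, p.1 - p.2)) (fun p => (p.1 + p.2 + 1, p.1 - p.2))
  invFun q := if (q.1 + q.2) % 2 = 0 then Sum.inl ((q.1 + q.2) / 2, (q.1 - q.2) / 2)
    else Sum.inr ((q.1 + q.2 - 1) / 2, (q.1 - q.2 - 1) / 2)
  left_inv := by
    rintro (⟨r, s⟩ | ⟨r, s⟩)
    · have h : (r + s + (r - s)) % 2 = 0 := by omega
      simp only [Sum.elim_inl, h, if_true, Sum.inl.injEq, Prod.mk.injEq]
      omega
    · have h : ¬ (r + s + 1 + (r - s)) % 2 = 0 := by omega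
      simp only [Sum.elim_inr, h, if_false, Sum.inr.injEq, Prod.mk.injEq]
      omega
  right_inv := by
    rintro ⟨m, n⟩
    by_cases h : (m + n) % 2 = 0
    · simp only [h, if_true, Sum.elim_inl, Prod.mk.injEq]
      omega
    · simp only [h, if_false, Sum.elim_inr, Prod.mk.injEq]
      omega

lemma tsum_paritySplit {G : ℤ × ℤ → ℂ} (hG : Summable G) :
    ∑' p, G p = ∑' p : ℤ × ℤ, G (p.1 + p.2, p.1 - p.2) +
      ∑' p : ℤ × ℤ, G (p.1 + p.2 + 1, p.1 - p.2) := by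
  have h := (paritySplit.summable_iff (f := G)).2 hG
  rw [← paritySplit.tsum_eq G]
  have h1 : Summable ((G ∘ paritySplit) ∘ Sum.inl) := h.comp_injective Sum.inl_injective
  have h2 : Summable ((G ∘ paritySplit) ∘ Sum.inr) := h.comp_injective Sum.inr_injective
  exact (HasSum.sum h1.hasSum h2.hasSum).tsum_eq

lemma summable_norm_theta_term (z : ℂ) {τ : ℂ} (hτ : 0 < τ.im) :
    Summable fun n : ℤ => ‖jacobiTheta₂_term n z τ‖ :=
  ((summable_jacobiTheta₂_term_iff z τ).2 hτ).norm

/-- Addition formula expressing a product of theta functions at `τ` through those at `2τ`. -/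
lemma theta_mul_theta (z w : ℂ) {τ : ℂ} (hτ : 0 < τ.im) :
    jacobiTheta₂ z τ * jacobiTheta₂ w τ =
      jacobiTheta₂ (z + w) (2 * τ) * jacobiTheta₂ (z - w) (2 * τ) +
        cexp (π * I * τ + 2 * π * I * z) *
          (jacobiTheta₂ (z + w + τ) (2 * τ) * jacobiTheta₂ (z - w + τ) (2 * τ)) := by
  have hτ2 : 0 < (2 * τ).im := by simpa using hτ
  have key (x y : ℂ) {σ : ℂ} (hσ : 0 < σ.im) : jacobiTheta₂ x σ * jacobiTheta₂ y σ =
      ∑' p : ℤ × ℤ, jacobiTheta₂_term p.1 x σ * jacobiTheta₂_term p.2 y σ :=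
    tsum_mul_tsum_of_summable_norm (summable_norm_theta_term x hσ) (summable_norm_theta_term y hσ)
  rw [key z w hτ, key (z + w) (z - w) hτ2, key (z + w + τ) (z - w + τ) hτ2, tsum_paritySplit
    (summable_mul_of_summable_norm (summable_norm_theta_term z hτ) (summable_norm_theta_term w hτ)),
    ← tsum_mul_left]
  congr 1 <;> refine tsum_congr fun p => ?_ <;>
    simp only [jacobiTheta₂_term, ← Complex.exp_add] <;> push_cast <;> congr 1 <;> ring

/-- The points `-τ - 1/2` and `τ - 1/2` differ by the quasi-period `2τ`, with multiplier `-1`, while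
evenness and period `1` force equal values there. -/
lemma theta_half_period {τ : ℂ} : jacobiTheta₂ (τ - 1 / 2) (2 * τ) = 0 := by
  have h := jacobiTheta₂_add_left' (-τ - 1 / 2) (2 * τ)
  have e1 : -τ - 1 / 2 + 2 * τ = τ - 1 / 2 := by ring
  have e2 : jacobiTheta₂ (-τ - 1 / 2) (2 * τ) = jacobiTheta₂ (τ - 1 / 2) (2 * τ) := by
    rw [← jacobiTheta₂_neg_left, ← jacobiTheta₂_add_left (τ - 1 / 2)]
    congr 1; ring
  have e3 : -(π : ℂ) * I * (2 * τ + 2 * (-τ - 1 / 2)) = π * I := by ring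
  rw [e1, e2, e3, Complex.exp_pi_mul_I] at h
  linear_combination h / 2

lemma theta_sub_half (z τ : ℂ) : jacobiTheta₂ (z - 1 / 2) τ = jacobiTheta₂ (z + 1 / 2) τ := by
  rw [← jacobiTheta₂_add_left (z - 1 / 2)]; congr 1; ring

/-- In the addition formula the difference of the arguments is the constant `1/2`, and the second
product contains the zero found in `theta_half_period`. -/
lemma theta_mul_theta_half (z : ℂ) {τ : ℂ} (hτ : 0 < τ.im) :
    jacobiTheta₂ (z - 1 / 2) τ * jacobiTheta₂ z τ =
      jacobiTheta₂ (2 * z - 1 / 2) (2 * τ) * jacobiTheta₂ (1 / 2) (2 * τ) := by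
  rw [mul_comm, theta_mul_theta z (z - 1 / 2) hτ]
  have e : z - (z - 1 / 2) + τ = τ + 1 / 2 := by ring
  rw [e, ← theta_sub_half, theta_half_period, show z + (z - 1 / 2) = 2 * z - 1 / 2 by ring,
    show z - (z - 1 / 2) = 1 / 2 by ring]
  ring

/-- The theta constant `θ₂`. -/
def thetaTwo (τ : ℂ) : ℂ := cexp (π * I * τ / 4) * jacobiTheta₂ (τ / 2) τ

lemma thetaTwo_sq_double (τ : ℂ) :
    thetaTwo (2 * τ) ^ 2 = cexp (π * I * τ) * jacobiTheta₂ τ (2 * τ) ^ 2 := by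
  rw [thetaTwo, mul_pow, ← Complex.exp_nat_mul]
  congr 2
  · push_cast; ring
  · congr 1; ring

/-- The three doubling formulas for theta constants are the addition formula at `z = w = 0`, `1/2`
and `τ/2`. They yield the quartic identity, and the first two also yield half of the AGM step. -/
lemma thetaThree_sq {τ : ℂ} (hτ : 0 < τ.im) :
    jacobiTheta₂ 0 τ ^ 2 = jacobiTheta₂ 0 (2 * τ) ^ 2 + thetaTwo (2 * τ) ^ 2 := by
  have := theta_mul_theta 0 0 hτ
  simp only [add_zero, sub_zero, zero_add, mul_zero] at this
  rw [sq, this, thetaTwo_sq_double]; ring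

lemma thetaFour_sq {τ : ℂ} (hτ : 0 < τ.im) :
    jacobiTheta₂ (1 / 2) τ ^ 2 = jacobiTheta₂ 0 (2 * τ) ^ 2 - thetaTwo (2 * τ) ^ 2 := by
  have h := theta_mul_theta (1 / 2) (1 / 2) hτ
  have e1 : jacobiTheta₂ (1 / 2 + 1 / 2) (2 * τ) = jacobiTheta₂ 0 (2 * τ) := by
    rw [← jacobiTheta₂_add_left 0]; norm_num
  have e2 : jacobiTheta₂ (1 / 2 + 1 / 2 + τ) (2 * τ) = jacobiTheta₂ τ (2 * τ) := by
    rw [← jacobiTheta₂_add_left τ]; congr 1; ring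
  have e3 : cexp (π * I * τ + 2 * π * I * (1 / 2)) = - cexp (π * I * τ) := by
    rw [show π * I * τ + 2 * π * I * (1 / 2) = π * I * τ + π * I by ring, Complex.exp_add,
      Complex.exp_pi_mul_I]; ring
  rw [e1, e2, e3, sub_self, zero_add] at h
  rw [sq, h, thetaTwo_sq_double]; ring

lemma thetaTwo_sq {τ : ℂ} (hτ : 0 < τ.im) :
    thetaTwo τ ^ 2 = 2 * thetaTwo (2 * τ) * jacobiTheta₂ 0 (2 * τ) := by
  have h := theta_mul_theta (τ / 2) (τ / 2) hτ
  have e1 : jacobiTheta₂ (τ / 2 + τ / 2 + τ) (2 * τ) =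
      cexp (-π * I * (2 * τ)) * jacobiTheta₂ 0 (2 * τ) := by
    have := jacobiTheta₂_add_left' 0 (2 * τ)
    rw [mul_zero, add_zero, zero_add] at this
    rw [← this]; congr 1; ring
  rw [e1, add_halves, sub_self, zero_add] at h
  have e2 : cexp (π * I * τ + 2 * π * I * (τ / 2)) * cexp (-π * I * (2 * τ)) = 1 := by
    rw [← Complex.exp_add, ← Complex.exp_zero]; congr 1; ring
  have e3 : cexp (π * I * τ / 4) ^ 2 = cexp (π * I * (2 * τ) / 4) := by
    rw [← Complex.exp_nat_mul]; congr 1; push_cast; ring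
  rw [thetaTwo, thetaTwo, mul_pow, e3, sq (jacobiTheta₂ _ _), h,
    show 2 * τ / 2 = τ by ring]
  linear_combination cexp (π * I * (2 * τ) / 4) * jacobiTheta₂ 0 (2 * τ) *
    jacobiTheta₂ τ (2 * τ) * e2

/-- Jacobi's quartic identity. -/
lemma jacobi_quartic {τ : ℂ} (hτ : 0 < τ.im) :
    jacobiTheta₂ 0 τ ^ 4 = thetaTwo τ ^ 4 + jacobiTheta₂ (1 / 2) τ ^ 4 := by
  -- With `A = θ₃(2τ)²` and `B = θ₂(2τ)²`, this is `(A + B)² - (A - B)² = 4AB`.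
  linear_combination (jacobiTheta₂ 0 τ ^ 2 + jacobiTheta₂ 0 (2 * τ) ^ 2 + thetaTwo (2 * τ) ^ 2) *
    thetaThree_sq hτ - (thetaTwo τ ^ 2 + 2 * thetaTwo (2 * τ) * jacobiTheta₂ 0 (2 * τ)) *
    thetaTwo_sq hτ - (jacobiTheta₂ (1 / 2) τ ^ 2 + jacobiTheta₂ 0 (2 * τ) ^ 2 -
      thetaTwo (2 * τ) ^ 2) * thetaFour_sq hτ

/-- The heat equation for the theta function. -/
lemma hasDerivAt_jacobiTheta₂' (z : ℂ) {τ : ℂ} (hτ : 0 < τ.im) :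
    HasDerivAt (jacobiTheta₂' · τ) (4 * π * I * deriv (jacobiTheta₂ z) τ) z := by
  have h1 : HasSum (fun n : ℤ => π * I * n ^ 2 * jacobiTheta₂_term n z τ)
      (deriv (jacobiTheta₂ z) τ) := by
    have hd : HasDerivAt (jacobiTheta₂ z) ((jacobiTheta₂_fderiv z τ) (0, 1)) τ :=
      ((hasFDerivAt_jacobiTheta₂ z hτ).comp τ (hasFDerivAt_prodMk_right z τ)).hasDerivAt
    rw [hd.deriv]
    have := (ContinuousLinearMap.apply ℂ ℂ ((0, 1) : ℂ × ℂ)).hasSum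
      (hasSum_jacobiTheta₂_term_fderiv z hτ)
    convert! this using 1
    ext n
    simp [jacobiTheta₂_term_fderiv, jacobiTheta₂_term, mul_comm]
  have hterm (n : ℤ) (x : ℂ) : HasDerivAt (jacobiTheta₂'_term n · τ)
      (4 * π * I * (π * I * n ^ 2 * jacobiTheta₂_term n x τ)) x := by
    have : HasDerivAt (fun x => 2 * π * I * n * cexp (2 * π * I * n * x + π * I * n ^ 2 * τ))
        (2 * π * I * n * (cexp (2 * π * I * n * x + π * I * n ^ 2 * τ) * (2 * π * I * n * 1))) x :=
      (((hasDerivAt_id x).const_mul _).add_const _).cexp.const_mul _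
    convert! this using 1
    simp only [jacobiTheta₂_term]; ring
  -- Termwise differentiation needs a majorant uniform near `z`. On the strip `|Im x| < S` the
  -- Gaussian decay in `n` dominates the linear exponent.
  set S := |z.im| + 1
  set U : Set ℂ := {x | |x.im| < S}
  have hU : IsOpen U := isOpen_lt (continuous_abs.comp Complex.continuous_im) continuous_const
  have hz : z ∈ U := by simp [U, S]
  have hsum : Summable fun n : ℤ =>
      2 * π * |(n : ℝ)| * Real.exp (-π * (τ.im * n ^ 2 - 2 * S * |n|)) := by
    have := (summable_pow_mul_jacobiTheta₂_term_bound S hτ 1).mul_left (2 * π)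
    simpa [mul_assoc] using this
  have hb : ∀ (n : ℤ) (x : ℂ), x ∈ U → ‖jacobiTheta₂'_term n x τ‖ ≤
      2 * π * |(n : ℝ)| * Real.exp (-π * (τ.im * n ^ 2 - 2 * S * |n|)) := fun n x hx => by
    simpa using norm_jacobiTheta₂'_term_le hτ (le_of_lt hx) le_rfl n
  have hdiff : ∀ n : ℤ, DifferentiableOn ℂ (jacobiTheta₂'_term n · τ) U :=
    fun n x _ => (hterm n x).differentiableAt.differentiableWithinAt
  have h2 := Complex.hasSum_deriv_of_summable_norm hsum hdiff hU hb hz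
  have h3 := Complex.differentiableOn_tsum_of_summable_norm hsum hdiff hU hb
  have h4 : deriv (fun w => ∑' n : ℤ, jacobiTheta₂'_term n w τ) z =
      4 * π * I * deriv (jacobiTheta₂ z) τ := by
    refine h2.unique ?_
    convert! h1.mul_left (4 * π * I) using 1
    ext n
    exact (hterm n z).deriv
  rw [← h4]
  exact ((h3 z hz).differentiableAt (hU.mem_nhds hz)).hasDerivAt

/-! ### Theta values at purely imaginary period: positivity, inversion, doubling and limits. -/

lemma exists_pos_theta_imag (y : ℝ) {t : ℝ} (ht : 0 < t) :
    ∃ r : ℝ, 0 < r ∧ jacobiTheta₂ (y * I) (t * I) = r := by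
  have hτ : 0 < ((t : ℂ) * I).im := by simpa using ht
  have hterm (n : ℤ) : jacobiTheta₂_term n (y * I) (t * I) =
      (Real.exp (-(2 * π * n * y) - π * n ^ 2 * t) : ℝ) := by
    rw [jacobiTheta₂_term]; push_cast; congr 1
    linear_combination (2 * π * n * y + π * n ^ 2 * t) * I_sq
  have hs := (summable_jacobiTheta₂_term_iff (y * I) (t * I)).2 hτ
  simp only [hterm] at hs
  have hs' := Complex.summable_ofReal.1 hs
  refine ⟨∑' n : ℤ, Real.exp (-(2 * π * n * y) - π * n ^ 2 * t),
    hs'.tsum_pos (fun n => (Real.exp_pos _).le) 0 (Real.exp_pos _), ?_⟩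
  rw [jacobiTheta₂, Complex.ofReal_tsum]
  exact tsum_congr hterm

lemma theta_functional_imag (x : ℝ) {t : ℝ} (ht : 0 < t) :
    jacobiTheta₂ x (t * I) = (1 / √t * Real.exp (-π * x ^ 2 / t) : ℝ) *
      jacobiTheta₂ ((x / t : ℝ) * I) ((1 / t : ℝ) * I) := by
  have ht' : (t : ℂ) ≠ 0 := by exact_mod_cast ht.ne'
  rw [jacobiTheta₂_functional_equation, ← jacobiTheta₂_neg_left]
  have e1 : -I * (t * I) = t := by linear_combination -t * I_sq
  have e2 : (t : ℂ) ^ (1 / 2 : ℂ) = (√t : ℝ) := by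
    rw [Real.sqrt_eq_rpow, Complex.ofReal_cpow ht.le]; norm_num
  have e3 : -((x : ℂ) / (t * I)) = (x / t : ℝ) * I := by
    push_cast; field_simp; linear_combination -x * I_sq
  have e4 : -1 / ((t : ℂ) * I) = (1 / t : ℝ) * I := by
    push_cast; field_simp; linear_combination - I_sq
  have e5 : -(π : ℂ) * I * x ^ 2 / (t * I) = (-π * x ^ 2 / t : ℝ) := by
    push_cast; field_simp
  rw [e1, e2, e3, e4, e5]
  push_cast; ring

/-- At real argument the terms of the series carry phases. The imaginary transformation moves the
argument to the imaginary axis, where every term is a positive exponential. -/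
lemma exists_pos_theta_real (x : ℝ) {t : ℝ} (ht : 0 < t) :
    ∃ r : ℝ, 0 < r ∧ jacobiTheta₂ x (t * I) = r := by
  obtain ⟨r, hr, h⟩ := exists_pos_theta_imag (x / t) (one_div_pos.2 ht)
  refine ⟨1 / √t * Real.exp (-π * x ^ 2 / t) * r, by positivity, ?_⟩
  rw [theta_functional_imag x ht, h]; push_cast; ring

/-- `θ₃(0 | it)` as a real number. -/
def th3 (t : ℝ) : ℝ := (jacobiTheta₂ 0 (t * I)).re

/-- `θ₄(0 | it)` as a real number. -/
def th4 (t : ℝ) : ℝ := (jacobiTheta₂ (1 / 2) (t * I)).re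

/-- `θ₂(0 | it)` as a real number. -/
def th2 (t : ℝ) : ℝ := (thetaTwo (t * I)).re

lemma theta_zero_eq {t : ℝ} (ht : 0 < t) : jacobiTheta₂ 0 (t * I) = th3 t ∧ 0 < th3 t := by
  obtain ⟨r, hr, h⟩ := exists_pos_theta_real 0 ht
  rw [Complex.ofReal_zero] at h
  simpa [th3, h] using hr

lemma theta_half_eq {t : ℝ} (ht : 0 < t) : jacobiTheta₂ (1 / 2) (t * I) = th4 t ∧ 0 < th4 t := by
  obtain ⟨r, hr, h⟩ := exists_pos_theta_real (1 / 2) ht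
  rw [show ((1 / 2 : ℝ) : ℂ) = 1 / 2 by push_cast; rfl] at h
  rw [th4, h]
  exact ⟨rfl, hr⟩

lemma thetaTwo_imag {t : ℝ} : thetaTwo (t * I) =
    (Real.exp (-π * t / 4) : ℝ) * jacobiTheta₂ ((t / 2 : ℝ) * I) (t * I) := by
  rw [thetaTwo]; push_cast
  congr 2
  · linear_combination (π * t / 4 : ℂ) * I_sq
  · ring

lemma thetaTwo_eq {t : ℝ} (ht : 0 < t) : thetaTwo (t * I) = th2 t ∧ 0 < th2 t := by
  obtain ⟨r, hr, h⟩ := exists_pos_theta_imag (t / 2) ht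
  have e : thetaTwo (t * I) = (Real.exp (-π * t / 4) * r : ℝ) := by
    rw [thetaTwo_imag, h]; push_cast; rfl
  rw [th2, e]
  exact ⟨rfl, mul_pos (Real.exp_pos _) hr⟩

lemma th3_functional {t : ℝ} (ht : 0 < t) : th3 (1 / t) = √t * th3 t := by
  have h := theta_functional_imag 0 ht
  have hs : √t ≠ 0 := (Real.sqrt_pos.2 ht).ne'
  simp only [Complex.ofReal_zero, zero_div, zero_mul, (theta_zero_eq ht).1,
    (theta_zero_eq (one_div_pos.2 ht)).1] at h
  norm_num at h
  have h' : th3 t = (√t)⁻¹ * th3 (t⁻¹) := by exact_mod_cast h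
  rw [h', one_div]; field_simp

lemma th2_functional {t : ℝ} (ht : 0 < t) : th2 (1 / t) = √t * th4 t := by
  have h := theta_functional_imag (1 / 2) ht
  have hs : √t ≠ 0 := (Real.sqrt_pos.2 ht).ne'
  have h2 := thetaTwo_imag (t := 1 / t)
  rw [(thetaTwo_eq (one_div_pos.2 ht)).1] at h2
  rw [show ((1 / 2 : ℝ) : ℂ) = 1 / 2 by push_cast; rfl, (theta_half_eq ht).1,
    show (1 / 2 / t : ℝ) = 1 / t / 2 by ring, show -π * (1 / 2) ^ 2 / t = -π * (1 / t) / 4 by ring,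
    Complex.ofReal_mul, mul_assoc, ← h2] at h
  have h' : th4 t = 1 / √t * th2 (1 / t) := by exact_mod_cast h
  rw [h']; field_simp

/-- Together with `th3_mul_th4` this is the AGM step: the arithmetic and geometric means of `θ₃²`
and `θ₄²` at `t` are their values at `2t`. -/
lemma th3_sq_add {t : ℝ} (ht : 0 < t) : th3 t ^ 2 + th4 t ^ 2 = 2 * th3 (2 * t) ^ 2 := by
  have hτ : 0 < ((t : ℂ) * I).im := by simpa using ht
  have h3 := thetaThree_sq hτ
  have h4 := thetaFour_sq hτ
  have e : 2 * ((t : ℂ) * I) = ((2 * t : ℝ) : ℂ) * I := by push_cast; ring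
  rw [e, (theta_zero_eq ht).1, (theta_zero_eq (by positivity : 0 < 2 * t)).1] at h3
  rw [e, (theta_half_eq ht).1, (theta_zero_eq (by positivity : 0 < 2 * t)).1] at h4
  have : (th3 t : ℂ) ^ 2 + (th4 t : ℂ) ^ 2 = 2 * (th3 (2 * t) : ℂ) ^ 2 := by
    linear_combination h3 + h4
  exact_mod_cast this

lemma th3_mul_th4 {t : ℝ} (ht : 0 < t) : th3 t * th4 t = th4 (2 * t) ^ 2 := by
  have hτ : 0 < ((t : ℂ) * I).im := by simpa using ht
  have h := theta_mul_theta_half 0 hτ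
  have e : 2 * ((t : ℂ) * I) = ((2 * t : ℝ) : ℂ) * I := by push_cast; ring
  rw [e, mul_zero, theta_sub_half, theta_sub_half, zero_add, (theta_half_eq ht).1,
    (theta_zero_eq ht).1, (theta_half_eq (by positivity : 0 < 2 * t)).1] at h
  have : th4 t * th3 t = th4 (2 * t) * th4 (2 * t) := by exact_mod_cast h
  linarith

lemma th_quartic {t : ℝ} (ht : 0 < t) : th3 t ^ 4 = th2 t ^ 4 + th4 t ^ 4 := by
  have hτ : 0 < ((t : ℂ) * I).im := by simpa using ht
  have h := jacobi_quartic hτ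
  rw [(theta_zero_eq ht).1, (thetaTwo_eq ht).1, (theta_half_eq ht).1] at h
  exact_mod_cast h

lemma tendsto_th3 : Tendsto th3 atTop (𝓝 1) := by
  have h : Tendsto (fun t : ℝ => 2 / (1 - Real.exp (-π * t)) * Real.exp (-π * t)) atTop (𝓝 0) := by
    have h0 : Tendsto (fun t : ℝ => Real.exp (-π * t)) atTop (𝓝 0) :=
      Real.tendsto_exp_atBot.comp (tendsto_id.const_mul_atTop_of_neg (neg_lt_zero.2 Real.pi_pos))
    have := (tendsto_const_nhds (x := (2 : ℝ))).div (h0.const_sub 1) (by norm_num)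
    simpa using this.mul h0
  rw [tendsto_iff_norm_sub_tendsto_zero]
  refine squeeze_zero' (Eventually.of_forall fun _ => norm_nonneg _) ?_ h
  filter_upwards [eventually_gt_atTop 0] with t ht
  have hτ : 0 < ((t : ℂ) * I).im := by simpa using ht
  have := norm_jacobiTheta_sub_one_le hτ
  rw [jacobiTheta_eq_jacobiTheta₂, (theta_zero_eq ht).1] at this
  simp only [Complex.mul_im, Complex.ofReal_re, Complex.I_im, Complex.ofReal_im, Complex.I_re,
    mul_zero, mul_one, add_zero] at this
  rw [← Complex.norm_real]
  simpa using this

lemma tendsto_th4_sq : Tendsto (fun t => th4 t ^ 2) atTop (𝓝 1) := by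
  have h2 : Tendsto (fun t => th3 (2 * t)) atTop (𝓝 1) :=
    tendsto_th3.comp (tendsto_id.const_mul_atTop two_pos)
  have h := ((h2.pow 2).const_mul 2).sub (tendsto_th3.pow 2)
  norm_num at h
  refine h.congr' ?_
  filter_upwards [eventually_gt_atTop 0] with t ht
  linarith [th3_sq_add ht]

end Theta

/-! ### Complete elliptic integrals in terms of the parameter `m` -/

section Elliptic

open Real Set MeasureTheory
open scoped Interval

/-- Differentiation under the integral sign for integrands depending continuously on both
variables. -/
lemma hasDerivAt_integral_of_continuousOn {𝕜 : Type*} [RCLike 𝕜] {f f' : 𝕜 → ℝ → 𝕜}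
    {U : Set 𝕜} {a b : ℝ} (hab : a ≤ b) (hU : IsOpen U)
    (hf : ∀ x ∈ U, ContinuousOn (f x) (Icc a b))
    (hd : ∀ x ∈ U, ∀ t ∈ Icc a b, HasDerivAt (fun y => f y t) (f' x t) x)
    (hf' : ContinuousOn (fun p : 𝕜 × ℝ => f' p.1 p.2) (U ×ˢ Icc a b)) {x₀ : 𝕜} (hx₀ : x₀ ∈ U) :
    HasDerivAt (fun x => ∫ t in a..b, f x t) (∫ t in a..b, f' x₀ t) x₀ := by
  obtain ⟨ε, hε, hball⟩ := Metric.nhds_basis_closedBall.mem_iff.1 (hU.mem_nhds hx₀)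
  have hK : IsCompact (Metric.closedBall x₀ ε ×ˢ Icc a b) :=
    (isCompact_closedBall x₀ ε).prod isCompact_Icc
  obtain ⟨M, hM⟩ := hK.exists_bound_of_continuousOn (hf'.mono (prod_mono_left hball))
  have hsub : Ι a b ⊆ Icc a b := by rw [uIoc_of_le hab]; exact Ioc_subset_Icc_self
  have hf'x : ContinuousOn (f' x₀) (Icc a b) :=
    hf'.comp (f := fun t : ℝ => (x₀, t)) (by fun_prop) fun t ht => ⟨hx₀, ht⟩
  refine (intervalIntegral.hasDerivAt_integral_of_dominated_loc_of_deriv_le (F' := f')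
    (bound := fun _ => M) (Metric.closedBall_mem_nhds x₀ hε) ?_ ?_ ?_ ?_ ?_ ?_).2
  · filter_upwards [hU.mem_nhds hx₀] with x hx
    exact ((hf x hx).mono hsub).aestronglyMeasurable measurableSet_uIoc
  · exact (by simpa [uIcc_of_le hab] using hf x₀ hx₀ :
      ContinuousOn (f x₀) (uIcc a b)).intervalIntegrable
  · exact (hf'x.mono hsub).aestronglyMeasurable measurableSet_uIoc
  · exact Eventually.of_forall fun t ht x hx => hM (x, t) ⟨hx, hsub ht⟩
  · exact intervalIntegrable_const
  · exact Eventually.of_forall fun t ht x hx => hd x (hball hx) t (hsub ht)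

/-- Complete elliptic integral of the first kind as a function of the parameter. -/
def eK (m : ℝ) : ℝ := ∫ φ in (0 : ℝ)..(π / 2), 1 / √(1 - m * sin φ ^ 2)

/-- Complete elliptic integral of the second kind as a function of the parameter. -/
def eE (m : ℝ) : ℝ := ∫ φ in (0 : ℝ)..(π / 2), √(1 - m * sin φ ^ 2)

lemma delta_pos {m : ℝ} (hm : m < 1) (φ : ℝ) : 0 < 1 - m * sin φ ^ 2 := by
  rcases (sq_nonneg (sin φ)).eq_or_lt with h | h
  · rw [← h]; simp
  · nlinarith [sin_sq_le_one φ]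

lemma sqrt_delta_pos {m : ℝ} (hm : m < 1) (φ : ℝ) : 0 < √(1 - m * sin φ ^ 2) :=
  Real.sqrt_pos.2 (delta_pos hm φ)

lemma continuous_sqrt_delta (m : ℝ) : Continuous fun φ => √(1 - m * sin φ ^ 2) := by fun_prop

lemma continuous_inv_sqrt_delta {m : ℝ} (hm : m < 1) :
    Continuous fun φ => 1 / √(1 - m * sin φ ^ 2) :=
  continuous_const.div (continuous_sqrt_delta m) fun φ => (sqrt_delta_pos hm φ).ne'

lemma eE_sub_eK {m : ℝ} (hm : m < 1) :
    eE m - eK m = -m * ∫ φ in (0 : ℝ)..(π / 2), sin φ ^ 2 / √(1 - m * sin φ ^ 2) := by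
  rw [eE, eK, ← intervalIntegral.integral_sub
    ((continuous_sqrt_delta m).intervalIntegrable _ _)
    ((continuous_inv_sqrt_delta hm).intervalIntegrable _ _), ← intervalIntegral.integral_const_mul]
  refine intervalIntegral.integral_congr fun φ _ => ?_
  have h := (sqrt_delta_pos hm φ).ne'
  have h2 := Real.sq_sqrt (delta_pos hm φ).le
  field_simp
  linear_combination h2

lemma hasDerivAt_eE {m : ℝ} (hm0 : m ≠ 0) (hm : m < 1) :
    HasDerivAt eE ((eE m - eK m) / (2 * m)) m := by
  have h := hasDerivAt_integral_of_continuousOn (f := fun m φ => √(1 - m * sin φ ^ 2))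
    (f' := fun m φ => -sin φ ^ 2 / (2 * √(1 - m * sin φ ^ 2))) (U := Iio 1) (by positivity :
      (0 : ℝ) ≤ π / 2) isOpen_Iio (fun x _ => (continuous_sqrt_delta x).continuousOn)
    (fun x hx φ _ => by
      have := (((hasDerivAt_id x).mul_const (sin φ ^ 2)).const_sub 1).sqrt (delta_pos hx φ).ne'
      simpa using this)
    (ContinuousOn.div (by fun_prop) (by fun_prop) fun p hp => by
      have := sqrt_delta_pos hp.1 p.2
      positivity) (mem_Iio.2 hm)
  convert! h using 1
  rw [eE_sub_eK hm, mul_div_assoc, div_eq_inv_mul (intervalIntegral _ _ _ _),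
    ← intervalIntegral.integral_const_mul, ← intervalIntegral.integral_const_mul]
  refine intervalIntegral.integral_congr fun φ _ => ?_
  have h := (sqrt_delta_pos hm φ).ne'
  field_simp

/-- Obtained by integrating the derivative of `sin φ cos φ / Δ`, which vanishes at both ends. It
expresses the derivative of `K` through `E` and `K`. -/
lemma integral_sin_sq_div_cube {m : ℝ} (hm : m < 1) :
    m * (1 - m) * ∫ φ in (0 : ℝ)..(π / 2), sin φ ^ 2 / √(1 - m * sin φ ^ 2) ^ 3 =
      eE m - (1 - m) * eK m := by
  have hcont : Continuous fun φ => sin φ ^ 2 / √(1 - m * sin φ ^ 2) ^ 3 :=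
    Continuous.div (by fun_prop) (by fun_prop) fun φ => (pow_pos (sqrt_delta_pos hm φ) 3).ne'
  have hder (φ : ℝ) : HasDerivAt (fun φ => -m * (sin φ * cos φ / √(1 - m * sin φ ^ 2)))
      (m * (1 - m) * (sin φ ^ 2 / √(1 - m * sin φ ^ 2) ^ 3) -
        (√(1 - m * sin φ ^ 2) - (1 - m) * (1 / √(1 - m * sin φ ^ 2)))) φ := by
    have h1 := ((((hasDerivAt_sin φ).pow 2).const_mul m).const_sub 1).sqrt (delta_pos hm φ).ne'
    have h2 := (((hasDerivAt_sin φ).mul (hasDerivAt_cos φ)).div h1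
      (sqrt_delta_pos hm φ).ne').const_mul (-m)
    refine h2.congr_deriv ?_
    have h := (sqrt_delta_pos hm φ).ne'
    have hs := Real.sq_sqrt (delta_pos hm φ).le
    have hc : cos φ ^ 2 = 1 - sin φ ^ 2 := by linarith [sin_sq_add_cos_sq φ]
    simp only [Pi.mul_apply, Pi.pow_apply, Nat.cast_ofNat, Nat.add_one_sub_one, pow_one]
    set D := √(1 - m * sin φ ^ 2)
    have hs2 : D ^ 4 = (1 - m * sin φ ^ 2) ^ 2 := by rw [← hs]; ring
    field_simp
    ring_nf
    simp only [hs2, hs, hc]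
    ring
  have hint := intervalIntegral.integral_eq_sub_of_hasDerivAt (a := 0) (b := π / 2)
    (fun φ _ => hder φ) (Continuous.intervalIntegrable (by
      exact (continuous_const.mul hcont).sub ((continuous_sqrt_delta m).sub
        (continuous_const.mul (continuous_inv_sqrt_delta hm)))) _ _)
  rw [intervalIntegral.integral_sub, intervalIntegral.integral_sub,
    intervalIntegral.integral_const_mul, intervalIntegral.integral_const_mul] at hint
  · simp only [sin_pi_div_two, cos_pi_div_two, sin_zero] at hint
    norm_num at hint
    simp only [one_div] at *
    rw [eE, eK]
    simp only [one_div]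
    linarith
  · exact (continuous_sqrt_delta m).intervalIntegrable _ _
  · exact (continuous_const.mul (continuous_inv_sqrt_delta hm)).intervalIntegrable _ _
  · exact (continuous_const.mul hcont).intervalIntegrable _ _
  · exact ((continuous_sqrt_delta m).sub
      (continuous_const.mul (continuous_inv_sqrt_delta hm))).intervalIntegrable _ _

lemma hasDerivAt_eK_integral {m : ℝ} (hm : m < 1) : HasDerivAt eK
    (∫ φ in (0 : ℝ)..(π / 2), sin φ ^ 2 / (2 * √(1 - m * sin φ ^ 2) ^ 3)) m := by
  refine hasDerivAt_integral_of_continuousOn (f := fun m φ => 1 / √(1 - m * sin φ ^ 2))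
    (f' := fun m φ => sin φ ^ 2 / (2 * √(1 - m * sin φ ^ 2) ^ 3)) (U := Iio 1) (by positivity :
      (0 : ℝ) ≤ π / 2) isOpen_Iio (fun x hx => (continuous_inv_sqrt_delta hx).continuousOn)
    (fun x hx φ _ => ?_)
    (ContinuousOn.div (by fun_prop) (by fun_prop) fun p hp => by
      have := sqrt_delta_pos hp.1 p.2
      positivity) (mem_Iio.2 hm)
  have h0 := sqrt_delta_pos hx φ
  have := ((((hasDerivAt_id x).mul_const (sin φ ^ 2)).const_sub 1).sqrt
    (delta_pos hx φ).ne').fun_inv h0.ne'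
  simp only [id, one_mul] at this
  simp only [one_div]
  refine this.congr_deriv ?_
  field_simp

lemma hasDerivAt_eK {m : ℝ} (hm0 : m ≠ 0) (hm : m < 1) :
    HasDerivAt eK ((eE m - (1 - m) * eK m) / (2 * m * (1 - m))) m := by
  refine (hasDerivAt_eK_integral hm).congr_deriv ?_
  have h1 : 1 - m ≠ 0 := by linarith
  rw [← integral_sin_sq_div_cube hm, show m * (1 - m) * (∫ φ in (0 : ℝ)..(π / 2),
    sin φ ^ 2 / √(1 - m * sin φ ^ 2) ^ 3) / (2 * m * (1 - m)) = 1 / 2 * ∫ φ in (0 : ℝ)..(π / 2),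
    sin φ ^ 2 / √(1 - m * sin φ ^ 2) ^ 3 by field_simp, ← intervalIntegral.integral_const_mul]
  refine intervalIntegral.integral_congr fun φ _ => ?_
  have h := (sqrt_delta_pos hm φ).ne'
  field_simp

lemma eK_strictMono {m n : ℝ} (hmn : m < n) (hn : n < 1) : eK m < eK n := by
  refine intervalIntegral.integral_lt_integral_of_continuousOn_of_le_of_exists_lt (by positivity)
    (continuous_inv_sqrt_delta (hmn.trans hn)).continuousOn
    (continuous_inv_sqrt_delta hn).continuousOn (fun φ _ => ?_)
    ⟨π / 2, ⟨by positivity, le_rfl⟩, ?_⟩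
  · refine one_div_le_one_div_of_le (sqrt_delta_pos hn φ) (Real.sqrt_le_sqrt ?_)
    nlinarith [sq_nonneg (sin φ)]
  · refine one_div_lt_one_div_of_lt (sqrt_delta_pos hn _) (Real.sqrt_lt_sqrt
      (delta_pos hn _).le ?_)
    simpa using hmn

lemma eK_zero : eK 0 = π / 2 := by simp [eK]

lemma eK_pos {m : ℝ} (hm : m < 1) : 0 < eK m :=
  intervalIntegral.intervalIntegral_pos_of_pos_on
    ((continuous_inv_sqrt_delta hm).intervalIntegrable _ _)
    (fun φ _ => one_div_pos.2 (sqrt_delta_pos hm φ)) (by positivity)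

lemma inv_sqrt_delta_le {m : ℝ} (hm0 : 0 ≤ m) (hm : m < 1) (φ : ℝ) :
    1 / √(1 - m * sin φ ^ 2) ≤ 1 / √(1 - m) := by
  refine one_div_le_one_div_of_le (Real.sqrt_pos.2 (by linarith)) (Real.sqrt_le_sqrt ?_)
  nlinarith [sin_sq_le_one φ]

lemma eK_le {m : ℝ} (hm0 : 0 ≤ m) (hm : m < 1) : eK m ≤ π / 2 / √(1 - m) := by
  have := intervalIntegral.integral_mono_on (a := 0) (b := π / 2) (by positivity)
    ((continuous_inv_sqrt_delta hm).intervalIntegrable _ _)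
    (intervalIntegrable_const (μ := volume) (c := 1 / √(1 - m))) (fun φ _ => inv_sqrt_delta_le hm0 hm φ)
  rw [intervalIntegral.integral_const] at this
  rw [eK]
  refine this.trans (le_of_eq ?_)
  simp only [sub_zero, smul_eq_mul]
  ring

/-- The factor `m` is what beats the growth of `K(1 - m)`, bounded by a multiple of `m^(-1/2)`, in
the limit that fixes Legendre's constant. -/
lemma abs_eK_sub_eE_le {m : ℝ} (hm0 : 0 ≤ m) (hm : m < 1) :
    |eK m - eE m| ≤ m * (π / 2 / √(1 - m)) := by
  have h := eE_sub_eK hm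
  have h0 : 0 ≤ ∫ φ in (0 : ℝ)..(π / 2), sin φ ^ 2 / √(1 - m * sin φ ^ 2) :=
    intervalIntegral.integral_nonneg (by positivity) fun φ _ => by positivity
  have h1 : ∫ φ in (0 : ℝ)..(π / 2), sin φ ^ 2 / √(1 - m * sin φ ^ 2) ≤ eK m := by
    refine intervalIntegral.integral_mono_on (by positivity) ?_
      ((continuous_inv_sqrt_delta hm).intervalIntegrable _ _) fun φ _ => ?_
    · exact (Continuous.div (by fun_prop) (continuous_sqrt_delta m)
        fun φ => (sqrt_delta_pos hm φ).ne').intervalIntegrable _ _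
    · exact div_le_div_of_nonneg_right (sin_sq_le_one φ) (sqrt_nonneg _)
  rw [show eK m - eE m = m * ∫ φ in (0 : ℝ)..(π / 2), sin φ ^ 2 / √(1 - m * sin φ ^ 2) by linarith,
    abs_of_nonneg (mul_nonneg hm0 h0)]
  exact mul_le_mul_of_nonneg_left (h1.trans (eK_le hm0 hm)) hm0

lemma abs_eE_one_sub_le {m : ℝ} (hm0 : 0 ≤ m) :
    |eE (1 - m) - 1| ≤ √m * (π / 2) := by
  have h1 : (1 : ℝ) = ∫ φ in (0 : ℝ)..(π / 2), cos φ := by simp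
  have h2 : eE (1 - m) - 1 = ∫ φ in (0 : ℝ)..(π / 2), (√(1 - (1 - m) * sin φ ^ 2) - cos φ) := by
    rw [intervalIntegral.integral_sub ((continuous_sqrt_delta _).intervalIntegrable _ _)
      (continuous_cos.intervalIntegrable _ _), ← h1, eE]
  rw [h2, ← Real.norm_eq_abs]
  refine (intervalIntegral.norm_integral_le_of_norm_le_const (C := √m) fun φ hφ => ?_).trans
    (le_of_eq ?_)
  · rw [uIoc_of_le (by positivity)] at hφ
    have hc : 0 ≤ cos φ := cos_nonneg_of_mem_Icc ⟨by linarith [pi_pos, hφ.1], hφ.2⟩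
    have hs := sin_sq_add_cos_sq φ
    rw [Real.norm_eq_abs, abs_le]
    constructor
    · have : cos φ ≤ √(1 - (1 - m) * sin φ ^ 2) :=
        Real.le_sqrt_of_sq_le (by nlinarith [sq_nonneg (sin φ)])
      linarith [sqrt_nonneg m]
    · rw [sub_le_iff_le_add]
      refine Real.sqrt_le_iff.2 ⟨by positivity, ?_⟩
      nlinarith [Real.sq_sqrt hm0, mul_nonneg (sqrt_nonneg m) hc, sin_sq_le_one φ]
  · rw [sub_zero, abs_of_pos (by positivity)]

/-- Legendre's relation. -/
lemma legendre_relation {m : ℝ} (hm0 : 0 < m) (hm1 : m < 1) :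
    eE m * eK (1 - m) + eE (1 - m) * eK m - eK m * eK (1 - m) = π / 2 := by
  set L : ℝ → ℝ := fun m => eE m * eK (1 - m) + eE (1 - m) * eK m - eK m * eK (1 - m) with hL
  have hd : ∀ x ∈ Ioo (0 : ℝ) 1, HasDerivAt L 0 x := fun x hx => by
    have h0 : x ≠ 0 := hx.1.ne'
    have h1 : 1 - x ≠ 0 := by linarith [hx.2]
    have hE := hasDerivAt_eE h0 hx.2
    have hK := hasDerivAt_eK h0 hx.2
    have hE' := (hasDerivAt_eE h1 (by linarith [hx.1])).comp_const_sub 1 x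
    have hK' := (hasDerivAt_eK h1 (by linarith [hx.1])).comp_const_sub 1 x
    refine (((hE.mul hK').add (hE'.mul hK)).sub (hK.mul hK')).congr_deriv ?_
    simp only [sub_sub_cancel]
    field_simp
    ring
  have hconst : ∀ x ∈ Ioo (0 : ℝ) 1, L x = L m := fun x hx =>
    (convex_Ioo (0 : ℝ) 1).is_const_of_fderivWithin_eq_zero
      (fun y hy => (hd y hy).differentiableAt.differentiableWithinAt)
      (fun y hy => by
        rw [fderivWithin_of_isOpen isOpen_Ioo hy, (hd y hy).hasFDerivAt.fderiv]
        simp) hx ⟨hm0, hm1⟩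
  -- The constant is read off as `m → 0` from the form `L = E(1 - m) K(m) - K(1 - m) (K(m) - E(m))`,
  -- whose last product tends to `0`.
  have hlim : Tendsto L (𝓝[>] 0) (𝓝 (π / 2)) := by
    have hev : ∀ᶠ x : ℝ in 𝓝[>] 0, x ∈ Ioo (0 : ℝ) 1 := Ioo_mem_nhdsGT one_pos
    have hsq : Tendsto (fun x : ℝ => √x) (𝓝[>] 0) (𝓝 0) := by
      have := (Real.continuous_sqrt.tendsto 0).mono_left (nhdsWithin_le_nhds (s := Ioi 0))
      simpa using this
    have hsq1 : Tendsto (fun x : ℝ => √(1 - x)) (𝓝[>] 0) (𝓝 1) := by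
      have : Continuous fun x : ℝ => √(1 - x) := by fun_prop
      have := (this.tendsto 0).mono_left (nhdsWithin_le_nhds (s := Ioi 0))
      simpa using this
    have hE1 : Tendsto (fun x => eE (1 - x)) (𝓝[>] 0) (𝓝 1) := by
      rw [tendsto_iff_norm_sub_tendsto_zero]
      refine squeeze_zero' (Eventually.of_forall fun _ => norm_nonneg _)
        (g := fun x => √x * (π / 2)) ?_ (by simpa using hsq.mul_const (π / 2))
      filter_upwards [hev] with x hx using abs_eE_one_sub_le hx.1.le
    have hK0 : Tendsto eK (𝓝[>] 0) (𝓝 (π / 2)) := by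
      have := (hasDerivAt_eK_integral (zero_lt_one' ℝ)).continuousAt.tendsto
      rw [eK_zero] at this
      exact this.mono_left nhdsWithin_le_nhds
    have hprod : Tendsto (fun x => eK (1 - x) * (eK x - eE x)) (𝓝[>] 0) (𝓝 0) := by
      refine squeeze_zero_norm' (a := fun x => √x * ((π / 2) ^ 2 / √(1 - x))) ?_ ?_
      · filter_upwards [hev] with x hx
        have h1 := eK_le (sub_nonneg.2 hx.2.le) (by linarith [hx.1] : 1 - x < 1)
        have h2 := abs_eK_sub_eE_le hx.1.le hx.2
        rw [sub_sub_cancel] at h1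
        rw [norm_mul, Real.norm_eq_abs, Real.norm_eq_abs, abs_of_pos (eK_pos (by linarith [hx.1]))]
        refine (mul_le_mul h1 h2 (abs_nonneg _) (by positivity)).trans (le_of_eq ?_)
        have hx0 : √x ≠ 0 := (Real.sqrt_pos.2 hx.1).ne'
        have := Real.mul_self_sqrt hx.1.le
        have hx1 : √(1 - x) ≠ 0 := (Real.sqrt_pos.2 (by linarith [hx.2])).ne'
        field_simp
        linear_combination -this
      · have := hsq.mul ((tendsto_const_nhds (x := (π / 2) ^ 2)).div hsq1 one_ne_zero)
        simpa using this
    have := (hE1.mul hK0).sub hprod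
    rw [one_mul, sub_zero] at this
    refine this.congr fun x => ?_
    simp only [hL]; ring
  have hlim2 : Tendsto L (𝓝[>] 0) (𝓝 (L m)) :=
    tendsto_const_nhds.congr' (by
      filter_upwards [Ioo_mem_nhdsGT (zero_lt_one' ℝ)] with x hx using (hconst x hx).symm)
  exact tendsto_nhds_unique hlim2 hlim

/-- The ratio of the complementary complete elliptic integral to `K`. -/
def periodRatio (m : ℝ) : ℝ := eK (1 - m) / eK m

lemma periodRatio_pos {m : ℝ} (hm0 : 0 < m) (hm1 : m < 1) : 0 < periodRatio m :=
  div_pos (eK_pos (by linarith)) (eK_pos hm1)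

/-- The numerator of the quotient rule is a Wronskian of `K'` and `K`; after inserting the
derivatives it contains exactly Legendre's combination. -/
lemma hasDerivAt_periodRatio {m : ℝ} (hm0 : 0 < m) (hm1 : m < 1) :
    HasDerivAt periodRatio (-π / (4 * m * (1 - m) * eK m ^ 2)) m := by
  have h1 : 1 - m ≠ 0 := by linarith
  have hK := hasDerivAt_eK hm0.ne' hm1
  have hK' := (hasDerivAt_eK h1 (by linarith)).comp_const_sub 1 m
  have hpos := (eK_pos hm1).ne'
  refine (hK'.div hK hpos).congr_deriv ?_
  have hL := legendre_relation hm0 hm1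
  simp only [sub_sub_cancel]
  have := hm0.ne'
  field_simp
  linear_combination (-4) * hL

lemma periodRatio_strictAnti {m n : ℝ} (hm : 0 < m) (hmn : m < n) (hn : n < 1) :
    periodRatio n < periodRatio m :=
  div_lt_div₀ (eK_strictMono (by linarith) (by linarith)) (eK_strictMono hmn hn).le
    (eK_pos (by linarith)).le (eK_pos (by linarith))

lemma periodRatio_injOn : InjOn periodRatio (Ioo 0 1) := fun m hm n hn h => by
  rcases lt_trichotomy m n with hlt | rfl | hlt
  · exact absurd h (periodRatio_strictAnti hm.1 hlt hn.2).ne'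
  · rfl
  · exact absurd h (periodRatio_strictAnti hn.1 hlt hm.2).ne

/-! ### Gauss's integral and its AGM invariance. -/

/-- Gauss's integral for the arithmetic-geometric mean. -/
def gaussI (x y : ℝ) : ℝ := ∫ φ in (0 : ℝ)..(π / 2), 1 / √(x ^ 2 * cos φ ^ 2 + y ^ 2 * sin φ ^ 2)

lemma gauss_pos {x y : ℝ} (hx : 0 < x) (hy : 0 < y) (φ : ℝ) :
    0 < x ^ 2 * cos φ ^ 2 + y ^ 2 * sin φ ^ 2 := by
  rcases eq_or_ne (sin φ) 0 with h | h
  · have : cos φ ^ 2 = 1 := by nlinarith [sin_sq_add_cos_sq φ]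
    rw [h, this]; positivity
  · positivity

lemma continuous_gauss {x y : ℝ} (hx : 0 < x) (hy : 0 < y) :
    Continuous fun φ => 1 / √(x ^ 2 * cos φ ^ 2 + y ^ 2 * sin φ ^ 2) :=
  Continuous.div (by fun_prop) (by fun_prop) fun φ => (Real.sqrt_pos.2 (gauss_pos hx hy φ)).ne'

lemma gaussI_eq {x y : ℝ} (hx : 0 < x) : gaussI x y = eK (1 - y ^ 2 / x ^ 2) / x := by
  rw [gaussI, eK, ← intervalIntegral.integral_div]
  refine intervalIntegral.integral_congr fun φ _ => ?_
  have : x ^ 2 * cos φ ^ 2 + y ^ 2 * sin φ ^ 2 =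
      x ^ 2 * (1 - (1 - y ^ 2 / x ^ 2) * sin φ ^ 2) := by
    field_simp
    linear_combination x ^ 2 * sin_sq_add_cos_sq φ
  simp only [this]
  rw [Real.sqrt_mul (sq_nonneg x), Real.sqrt_sq hx.le]
  ring

lemma gaussI_bounds {x y l u : ℝ} (hl : 0 < l) (hlx : l ≤ x) (hly : l ≤ y) (hxu : x ≤ u)
    (hyu : y ≤ u) : π / 2 / u ≤ gaussI x y ∧ gaussI x y ≤ π / 2 / l := by
  have hx := hl.trans_le hlx
  have hy := hl.trans_le hly
  have hu := hx.trans_le hxu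
  have hint := (continuous_gauss hx hy).intervalIntegrable (μ := volume) 0 (π / 2)
  have key (φ : ℝ) : l ≤ √(x ^ 2 * cos φ ^ 2 + y ^ 2 * sin φ ^ 2) ∧
      √(x ^ 2 * cos φ ^ 2 + y ^ 2 * sin φ ^ 2) ≤ u := by
    have h1 := sin_sq_add_cos_sq φ
    have a1 : l ^ 2 ≤ x ^ 2 := by gcongr
    have a2 : l ^ 2 ≤ y ^ 2 := by gcongr
    have a3 : x ^ 2 ≤ u ^ 2 := by gcongr
    have a4 : y ^ 2 ≤ u ^ 2 := by gcongr
    constructor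
    · refine Real.le_sqrt_of_sq_le ?_
      nlinarith [mul_nonneg (sub_nonneg.2 a1) (sq_nonneg (cos φ)),
        mul_nonneg (sub_nonneg.2 a2) (sq_nonneg (sin φ))]
    · refine Real.sqrt_le_iff.2 ⟨hu.le, ?_⟩
      nlinarith [mul_nonneg (sub_nonneg.2 a3) (sq_nonneg (cos φ)),
        mul_nonneg (sub_nonneg.2 a4) (sq_nonneg (sin φ))]
  constructor
  · have := intervalIntegral.integral_mono_on (a := 0) (b := π / 2) (by positivity)
      (intervalIntegrable_const (c := 1 / u)) hint
      (fun φ _ => one_div_le_one_div_of_le (hl.trans_le (key φ).1) (key φ).2)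
    rw [intervalIntegral.integral_const] at this
    refine (le_of_eq ?_).trans this
    simp only [sub_zero, smul_eq_mul]; ring
  · have := intervalIntegral.integral_mono_on (a := 0) (b := π / 2) (by positivity) hint
      (intervalIntegrable_const (c := 1 / l))
      (fun φ _ => one_div_le_one_div_of_le hl (key φ).1)
    rw [intervalIntegral.integral_const] at this
    refine this.trans (le_of_eq ?_)
    simp only [sub_zero, smul_eq_mul]; ring

/-- The new angle is the argument of `(cos φ + i sin φ)(x cos φ + i y sin φ)`. It runs over `[0, π)`
as `φ` runs over `[0, π/2)`, and the integrand after one AGM step pulls back to twice the original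
one. -/
lemma landen_deriv {x y φ : ℝ} (hx : 0 < x) (hy : 0 < y) (hc : 0 < cos φ) :
    1 / √(((x + y) / 2) ^ 2 * cos (φ + arctan (y / x * tan φ)) ^ 2 +
      √(x * y) ^ 2 * sin (φ + arctan (y / x * tan φ)) ^ 2) *
      (1 + 1 / (1 + (y / x * tan φ) ^ 2) * (y / x * (1 / cos φ ^ 2))) =
    2 * (1 / √(x ^ 2 * cos φ ^ 2 + y ^ 2 * sin φ ^ 2)) := by
  have hD := gauss_pos hx hy φ
  have hone := sin_sq_add_cos_sq φ
  have hcc := cos_add φ (arctan (y / x * tan φ))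
  rw [cos_arctan, sin_arctan] at hcc
  have hq : 1 + (y / x * tan φ) ^ 2 =
      (x ^ 2 * cos φ ^ 2 + y ^ 2 * sin φ ^ 2) / (x * cos φ) ^ 2 := by
    rw [tan_eq_sin_div_cos]; field_simp
  have hq0 : 0 ≤ 1 + (y / x * tan φ) ^ 2 := by positivity
  have hcos2 : cos (φ + arctan (y / x * tan φ)) ^ 2 =
      (x * cos φ ^ 2 - y * sin φ ^ 2) ^ 2 / (x ^ 2 * cos φ ^ 2 + y ^ 2 * sin φ ^ 2) := by
    have : cos (φ + arctan (y / x * tan φ)) =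
        (cos φ - sin φ * (y / x * tan φ)) / √(1 + (y / x * tan φ) ^ 2) := by rw [hcc]; ring
    rw [this, div_pow, Real.sq_sqrt hq0, hq, tan_eq_sin_div_cos]
    field_simp
  have hsin2 : sin (φ + arctan (y / x * tan φ)) ^ 2 = 1 -
      (x * cos φ ^ 2 - y * sin φ ^ 2) ^ 2 / (x ^ 2 * cos φ ^ 2 + y ^ 2 * sin φ ^ 2) := by
    rw [← hcos2]; linarith [sin_sq_add_cos_sq (φ + arctan (y / x * tan φ))]
  rw [hsin2, hcos2, Real.sq_sqrt (by positivity), hq]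
  set D := x ^ 2 * cos φ ^ 2 + y ^ 2 * sin φ ^ 2 with hDdef
  have hval : ((x + y) / 2) ^ 2 * ((x * cos φ ^ 2 - y * sin φ ^ 2) ^ 2 / D) +
      x * y * (1 - (x * cos φ ^ 2 - y * sin φ ^ 2) ^ 2 / D) = ((D + x * y) / (2 * √D)) ^ 2 := by
    rw [div_pow (D + x * y), mul_pow, Real.sq_sqrt hD.le]
    -- This factorisation makes the radicand a perfect square, through `xy + (D - xy)²/(4D) = (D +
    -- xy)²/(4D)`.
    have hDx : D - x * y = (x - y) * (x * cos φ ^ 2 - y * sin φ ^ 2) := by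
      rw [hDdef]; linear_combination x * y * hone
    field_simp
    linear_combination (-(D - x * y) - (x - y) * (x * cos φ ^ 2 - y * sin φ ^ 2)) * hDx
  rw [hval, Real.sqrt_sq (by positivity)]
  have hs : √D ≠ 0 := (Real.sqrt_pos.2 hD).ne'
  have hs2 := Real.sq_sqrt hD.le
  have : D + x * y ≠ 0 := by positivity
  have hc' := hc.ne'
  field_simp
  linear_combination hs2

/-- Gauss's invariance of the elliptic integral under the arithmetic-geometric mean step. -/
lemma gaussI_agm {x y : ℝ} (hx : 0 < x) (hy : 0 < y) :
    gaussI x y = gaussI ((x + y) / 2) √(x * y) := by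
  have hx1 : 0 < (x + y) / 2 := by positivity
  have hy1 : 0 < √(x * y) := Real.sqrt_pos.2 (by positivity)
  set f := fun φ => 1 / √(x ^ 2 * cos φ ^ 2 + y ^ 2 * sin φ ^ 2) with hf
  set g := fun φ => 1 / √(((x + y) / 2) ^ 2 * cos φ ^ 2 + √(x * y) ^ 2 * sin φ ^ 2) with hg
  have hfc : Continuous f := continuous_gauss hx hy
  have hgc : Continuous g := continuous_gauss hx1 hy1
  set F : ℝ → ℝ := fun b => ∫ φ in (0 : ℝ)..b, f φ
  set G : ℝ → ℝ := fun b => ∫ φ in (0 : ℝ)..b, g φ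
  have hF (b : ℝ) : HasDerivAt F (f b) b := hfc.integral_hasStrictDerivAt 0 b |>.hasDerivAt
  have hG (b : ℝ) : HasDerivAt G (g b) b := hgc.integral_hasStrictDerivAt 0 b |>.hasDerivAt
  set ψ : ℝ → ℝ := fun φ => φ + arctan (y / x * tan φ) with hψ
  have hder : ∀ φ ∈ Ico 0 (π / 2), HasDerivAt (fun φ => G (ψ φ) - 2 * F φ) 0 φ := fun φ hφ => by
    have hc : 0 < cos φ := cos_pos_of_mem_Ioo ⟨by linarith [pi_pos, hφ.1], hφ.2⟩
    have h1 : HasDerivAt ψ (1 + 1 / (1 + (y / x * tan φ) ^ 2) * (y / x * (1 / cos φ ^ 2))) φ :=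
      (hasDerivAt_id φ).add (((hasDerivAt_tan hc.ne').const_mul (y / x)).arctan)
    refine (((hG (ψ φ)).comp φ h1).sub ((hF φ).const_mul 2)).congr_deriv ?_
    rw [sub_eq_zero]
    exact landen_deriv hx hy hc
  have hzero : G (ψ 0) - 2 * F 0 = 0 := by simp [ψ, G, F]
  have hconst : ∀ b ∈ Ico 0 (π / 2), G (ψ b) = 2 * F b := fun b hb => by
    have := constant_of_has_deriv_right_zero (f := fun φ => G (ψ φ) - 2 * F φ) (a := 0) (b := b)
      (fun φ hφ => (hder φ ⟨hφ.1, hφ.2.trans_lt hb.2⟩).continuousAt.continuousWithinAt)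
      (fun φ hφ => (hder φ ⟨hφ.1, hφ.2.trans hb.2⟩).hasDerivWithinAt) b ⟨hb.1, le_rfl⟩
    simp only [hzero] at this
    linarith
  -- At `π/2` itself `tan` has the default value `0`, so `ψ` has the wrong value there and the
  -- endpoint `π` is reached only as a limit.
  have hψlim : Tendsto ψ (𝓝[<] (π / 2)) (𝓝 (π / 2 + π / 2)) :=
    (tendsto_id.mono_left nhdsWithin_le_nhds).add
      ((tendsto_arctan_atTop.mono_right nhdsWithin_le_nhds).comp
        (tendsto_tan_pi_div_two.const_mul_atTop (div_pos hy hx)))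
  have hlim1 : Tendsto (fun b => G (ψ b)) (𝓝[<] (π / 2)) (𝓝 (G (π / 2 + π / 2))) :=
    ((hG _).continuousAt.tendsto).comp hψlim
  have hlim2 : Tendsto (fun b => 2 * F b) (𝓝[<] (π / 2)) (𝓝 (2 * F (π / 2))) :=
    ((hF _).continuousAt.tendsto.mono_left nhdsWithin_le_nhds).const_mul 2
  have heq : G (π / 2 + π / 2) = 2 * F (π / 2) := by
    refine tendsto_nhds_unique (hlim1.congr' ?_) hlim2
    filter_upwards [Ico_mem_nhdsLT (by positivity : (0 : ℝ) < π / 2)] with b hb using hconst b hb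
  have hsym : ∫ φ in (π / 2)..(π / 2 + π / 2), g φ = ∫ φ in (0 : ℝ)..(π / 2), g φ := by
    have h := intervalIntegral.integral_comp_sub_left (a := 0) (b := π / 2) g π
    have e1 : π - π / 2 = π / 2 := by ring
    rw [e1, sub_zero] at h
    rw [add_halves, ← h]
    refine intervalIntegral.integral_congr fun φ _ => ?_
    simp only [hg, cos_pi_sub, sin_pi_sub, neg_sq]
  have hG2 : G (π / 2 + π / 2) = 2 * G (π / 2) := by
    have := intervalIntegral.integral_add_adjacent_intervals
      (hgc.intervalIntegrable (μ := volume) 0 (π / 2))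
      (hgc.intervalIntegrable (μ := volume) (π / 2) (π / 2 + π / 2))
    rw [hsym] at this
    simp only [G]
    linarith
  have : F (π / 2) = G (π / 2) := by linarith
  exact this

end Elliptic

/-! ### Theta constants and elliptic integrals -/

section ThetaElliptic

open Real Set

lemma gaussI_theta_double {t : ℝ} (ht : 0 < t) :
    gaussI (th3 t ^ 2) (th4 t ^ 2) = gaussI (th3 (2 * t) ^ 2) (th4 (2 * t) ^ 2) := by
  have h3 := (theta_zero_eq ht).2
  have h4 := (theta_half_eq ht).2
  rw [gaussI_agm (by positivity) (by positivity), th3_sq_add ht, ← mul_pow,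
    Real.sqrt_sq (by positivity), th3_mul_th4 ht]
  congr 1; ring

/-- Repeated doubling of `t` leaves the integral unchanged while both entries tend to `1`;
`gaussI_bounds` then squeezes the value. -/
lemma gaussI_theta {t : ℝ} (ht : 0 < t) : gaussI (th3 t ^ 2) (th4 t ^ 2) = π / 2 := by
  have hiter (n : ℕ) : gaussI (th3 t ^ 2) (th4 t ^ 2) =
      gaussI (th3 (2 ^ n * t) ^ 2) (th4 (2 ^ n * t) ^ 2) := by
    induction n with
    | zero => simp
    | succ n ih => rw [ih, gaussI_theta_double (by positivity)]; congr 3 <;> ring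
  have hlim : Tendsto (fun n : ℕ => (2 : ℝ) ^ n * t) atTop atTop :=
    (tendsto_pow_atTop_atTop_of_one_lt one_lt_two).atTop_mul_const ht
  have h3 : Tendsto (fun n : ℕ => th3 (2 ^ n * t) ^ 2) atTop (𝓝 1) := by
    simpa using (tendsto_th3.comp hlim).pow 2
  have h4 : Tendsto (fun n : ℕ => th4 (2 ^ n * t) ^ 2) atTop (𝓝 1) := tendsto_th4_sq.comp hlim
  have hmin := h3.min h4
  have hmax := h3.max h4
  rw [min_self] at hmin
  rw [max_self] at hmax
  have hb (n : ℕ) := gaussI_bounds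
    (lt_min (pow_pos (theta_zero_eq (by positivity : 0 < 2 ^ n * t)).2 2)
      (pow_pos (theta_half_eq (by positivity : 0 < 2 ^ n * t)).2 2))
    (min_le_left _ _) (min_le_right _ _) (le_max_left _ _) (le_max_right _ _)
  refine le_antisymm ?_ ?_
  · refine ge_of_tendsto (x := atTop) (f := fun n : ℕ => π / 2 /
      min (th3 (2 ^ n * t) ^ 2) (th4 (2 ^ n * t) ^ 2)) ?_
      (Eventually.of_forall fun n => (hiter n).le.trans (hb n).2)
    have := (tendsto_const_nhds (x := π / 2)).div hmin one_ne_zero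
    rwa [div_one] at this
  · refine le_of_tendsto (x := atTop) (f := fun n : ℕ => π / 2 /
      max (th3 (2 ^ n * t) ^ 2) (th4 (2 ^ n * t) ^ 2)) ?_
      (Eventually.of_forall fun n => (hb n).1.trans (hiter n).ge)
    have := (tendsto_const_nhds (x := π / 2)).div hmax one_ne_zero
    rwa [div_one] at this

/-- The elliptic parameter attached to the theta constants at `it`. -/
def thetaParam (t : ℝ) : ℝ := 1 - th4 t ^ 4 / th3 t ^ 4

lemma eK_thetaParam {t : ℝ} (ht : 0 < t) : eK (thetaParam t) = π / 2 * th3 t ^ 2 := by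
  have h3 := (theta_zero_eq ht).2
  have h := gaussI_theta ht
  rw [gaussI_eq (by positivity)] at h
  have e : 1 - (th4 t ^ 2) ^ 2 / (th3 t ^ 2) ^ 2 = thetaParam t := by rw [thetaParam]; ring
  rw [e] at h
  field_simp at h
  linarith

/-- Under `t ↦ 1/t` the constants `θ₂` and `θ₄` are exchanged and `θ₃` is kept, up to the common
factor `√t`; the quartic identity does the rest. -/
lemma thetaParam_inv {t : ℝ} (ht : 0 < t) : thetaParam (1 / t) = 1 - thetaParam t := by
  have h3 := (theta_zero_eq ht).2
  have hs := Real.sqrt_pos.2 ht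
  have e3 := th3_functional ht
  have e4 : th4 (1 / t) = √t * th2 t := by
    have := th2_functional (one_div_pos.2 ht)
    rw [one_div_one_div] at this
    rw [this, ← mul_assoc, ← Real.sqrt_mul ht.le, mul_one_div_cancel ht.ne', Real.sqrt_one, one_mul]
  rw [thetaParam, thetaParam, e3, e4, mul_pow, mul_pow]
  have := th_quartic ht
  field_simp
  linarith

lemma thetaParam_mem {t : ℝ} (ht : 0 < t) : thetaParam t ∈ Ioo 0 1 := by
  have key {s : ℝ} (hs : 0 < s) : thetaParam s < 1 := by
    have h3 := (theta_zero_eq hs).2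
    have h4 := (theta_half_eq hs).2
    rw [thetaParam]
    have : 0 < th4 s ^ 4 / th3 s ^ 4 := by positivity
    linarith
  have := key (one_div_pos.2 ht)
  rw [thetaParam_inv ht] at this
  exact ⟨by linarith, key ht⟩

lemma periodRatio_thetaParam {t : ℝ} (ht : 0 < t) : periodRatio (thetaParam t) = t := by
  have h3 := (theta_zero_eq ht).2
  rw [periodRatio, ← thetaParam_inv ht, eK_thetaParam ht, eK_thetaParam (one_div_pos.2 ht),
    th3_functional ht, mul_pow, Real.sq_sqrt ht.le]
  field_simp

/-- `periodRatio_thetaParam` gives only a right inverse of `periodRatio`; injectivity on `(0, 1)`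
makes it two-sided, so that `eK_thetaParam` applies at an arbitrary `m`. -/
lemma th3_periodRatio_sq {m : ℝ} (hm0 : 0 < m) (hm1 : m < 1) :
    th3 (periodRatio m) ^ 2 = 2 * eK m / π := by
  have ht := periodRatio_pos hm0 hm1
  have : thetaParam (periodRatio m) = m :=
    periodRatio_injOn (thetaParam_mem ht) ⟨hm0, hm1⟩ (periodRatio_thetaParam ht)
  have h := eK_thetaParam ht
  rw [this] at h
  rw [h]
  field_simp

/-- The second logarithmic derivative at `0` of the theta function whose period ratio is that of
the elliptic parameter `m`. -/
lemma heat_theta_periodRatio {m : ℝ} (hm0 : 0 < m) (hm1 : m < 1) :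
    4 * π * Complex.I * deriv (jacobiTheta₂ 0) (periodRatio m * Complex.I) =
      (4 * eK m * ((1 - m) * eK m - eE m) : ℝ) * jacobiTheta₂ 0 (periodRatio m * Complex.I) := by
  have ht := periodRatio_pos hm0 hm1
  have hτ : 0 < ((periodRatio m : ℂ) * Complex.I).im := by simpa using ht
  set D := deriv (jacobiTheta₂ 0) (periodRatio m * Complex.I) with hD
  have hd : HasDerivAt (jacobiTheta₂ 0) D (periodRatio m * Complex.I) :=
    (differentiableAt_jacobiTheta₂_snd 0 hτ).hasDerivAt
  have hr := (hasDerivAt_periodRatio hm0 hm1).ofReal_comp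
  -- The same function of `m` is differentiated by the chain rule and as `2K/π`; equating the two
  -- determines `D`.
  have h1 : HasDerivAt (fun x : ℝ => jacobiTheta₂ 0 (periodRatio x * Complex.I) ^ 2)
      (2 * jacobiTheta₂ 0 (periodRatio m * Complex.I) *
        (D * (((-π / (4 * m * (1 - m) * eK m ^ 2) : ℝ) : ℂ) * Complex.I))) m := by
    have := (hd.comp m (hr.mul_const Complex.I)).fun_pow 2
    simpa using this
  have h2 := (((hasDerivAt_eK hm0.ne' hm1).const_mul 2).div_const π).ofReal_comp
  have h3 : (fun x : ℝ => jacobiTheta₂ 0 (periodRatio x * Complex.I) ^ 2) =ᶠ[𝓝 m]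
      fun x => ((2 * eK x / π : ℝ) : ℂ) := by
    filter_upwards [Ioo_mem_nhds hm0 hm1] with x hx
    rw [(theta_zero_eq (periodRatio_pos hx.1 hx.2)).1, ← th3_periodRatio_sq hx.1 hx.2]
    push_cast; rfl
  have h4 := (h2.congr_of_eventuallyEq h3).unique h1
  have h5 := th3_periodRatio_sq hm0 hm1
  have hθ := theta_zero_eq ht
  rw [hθ.1] at h4 ⊢
  have hT : (th3 (periodRatio m) : ℂ) ≠ 0 := by exact_mod_cast hθ.2.ne'
  have h5' : (th3 (periodRatio m) : ℂ) ^ 2 = 2 * eK m / π := by exact_mod_cast h5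
  have hK : (eK m : ℂ) ≠ 0 := by exact_mod_cast (eK_pos hm1).ne'
  have hm0' : (m : ℂ) ≠ 0 := by exact_mod_cast hm0.ne'
  have hm1' : (1 - m : ℂ) ≠ 0 := by exact_mod_cast (by linarith : (1 - m : ℝ) ≠ 0)
  have hpi : (π : ℂ) ≠ 0 := by exact_mod_cast pi_ne_zero
  push_cast at h4 ⊢
  field_simp at h4 h5'
  refine mul_left_cancel₀ hT ?_
  refine mul_left_cancel₀ hpi ?_
  linear_combination (-4 * eK m * ((1 - m) * eK m - eE m)) * h5' + 2 * h4

end ThetaElliptic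

/-! ### The periods of the elliptic curve -/

section Periods

open Real Set MeasureTheory

/-- The incomplete elliptic integral of the first kind. -/
def eF (m φ : ℝ) : ℝ := ∫ ψ in (0 : ℝ)..φ, 1 / √(1 - m * sin ψ ^ 2)

lemma eF_zero (m : ℝ) : eF m 0 = 0 := intervalIntegral.integral_same

lemma eF_pi_div_two (m : ℝ) : eF m (π / 2) = eK m := rfl

lemma eF_neg (m φ : ℝ) : eF m (-φ) = -eF m φ := by
  have h := intervalIntegral.integral_comp_neg (a := 0) (b := φ)
    (fun ψ => 1 / √(1 - m * sin ψ ^ 2))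
  simp only [sin_neg, neg_sq, neg_zero] at h
  rw [eF, eF, h, intervalIntegral.integral_symm]

lemma hasDerivAt_eF {m : ℝ} (hm : m < 1) (φ : ℝ) :
    HasDerivAt (eF m) (1 / √(1 - m * sin φ ^ 2)) φ :=
  ((continuous_inv_sqrt_delta hm).integral_hasStrictDerivAt 0 φ).hasDerivAt

lemma continuous_eF {m : ℝ} (hm : m < 1) : Continuous (eF m) :=
  continuous_iff_continuousAt.2 fun φ => (hasDerivAt_eF hm φ).continuousAt

variable {c a : ℝ}

lemma div_sq_lt_one (ha : 0 < a) (hac : a < c) : (a / c) ^ 2 < 1 := by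
  have hc := ha.trans hac
  rw [div_pow, div_lt_one (by positivity)]
  gcongr

lemma div_sq_pos (ha : 0 < a) (hac : a < c) : 0 < (a / c) ^ 2 := by
  have hc := ha.trans hac
  positivity

/-- Substitution `y = a sin φ`. The integrand blows up at `±a`; its integrability follows from
nonnegativity and a primitive continuous up to the endpoints. -/
lemma integral_aPeriod (ha : 0 < a) (hac : a < c) :
    ∫ y in (-a)..a, 1 / (√(c ^ 2 - y ^ 2) * √(a ^ 2 - y ^ 2)) = 2 * eK ((a / c) ^ 2) / c := by
  have hc := ha.trans hac
  have hm := div_sq_lt_one ha hac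
  have hcont : ContinuousOn (fun y => eF ((a / c) ^ 2) (arcsin (y / a)) / c) (uIcc (-a) a) :=
    (((continuous_eF hm).comp (continuous_arcsin.comp (by fun_prop))).div_const c).continuousOn
  have hder : ∀ y ∈ Ioo (min (-a) a) (max (-a) a),
      HasDerivAt (fun y => eF ((a / c) ^ 2) (arcsin (y / a)) / c)
        (1 / (√(c ^ 2 - y ^ 2) * √(a ^ 2 - y ^ 2))) y := fun y hy => by
    rw [min_eq_left (by linarith), max_eq_right (by linarith)] at hy
    have h1 : -1 < y / a := by rw [lt_div_iff₀ ha]; linarith [hy.1]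
    have h2 : y / a < 1 := by rw [div_lt_iff₀ ha]; linarith [hy.2]
    have hd := (((hasDerivAt_eF hm (arcsin (y / a))).comp y
      (((hasDerivAt_arcsin h1.ne' h2.ne).comp y ((hasDerivAt_id y).div_const a)))).div_const c)
    refine hd.congr_deriv ?_
    rw [sin_arcsin h1.le h2.le]
    have e1 : c ^ 2 - y ^ 2 = c ^ 2 * (1 - (a / c) ^ 2 * (y / a) ^ 2) := by field_simp
    have e2 : a ^ 2 - y ^ 2 = a ^ 2 * (1 - (y / a) ^ 2) := by field_simp
    rw [e1, e2, Real.sqrt_mul (sq_nonneg c), Real.sqrt_mul (sq_nonneg a), Real.sqrt_sq hc.le,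
      Real.sqrt_sq ha.le]
    simp only [mul_inv, div_eq_mul_inv]
    ring
  rw [intervalIntegral.integral_eq_sub_of_hasDeriv_right hcont
    (fun y hy => (hder y hy).hasDerivWithinAt)
    (intervalIntegral.intervalIntegrable_deriv_of_nonneg hcont hder fun y _ => by positivity),
    div_self ha.ne', neg_div, div_self ha.ne', arcsin_neg, arcsin_one, eF_neg, eF_pi_div_two]
  ring

/-- Substitution `y = c √(1 - (1 - a²/c²) sin² φ)`, for which `X y = cos φ`; it decreases in `φ`,
hence the sign of the primitive. -/
lemma integral_bPeriod (ha : 0 < a) (hac : a < c) :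
    ∫ y in a..c, 1 / (√(c ^ 2 - y ^ 2) * √(y ^ 2 - a ^ 2)) = eK (1 - (a / c) ^ 2) / c := by
  have hc := ha.trans hac
  have hm : 1 - (a / c) ^ 2 < 1 := by linarith [div_sq_pos ha hac]
  have hca : 0 < c ^ 2 - a ^ 2 := by nlinarith
  set X : ℝ → ℝ := fun y => √((y ^ 2 - a ^ 2) / (c ^ 2 - a ^ 2)) with hX
  have hcont : ContinuousOn (fun y => -(eF (1 - (a / c) ^ 2) (arccos (X y)) / c)) (uIcc a c) :=
    (((continuous_eF hm).comp (continuous_arccos.comp (by fun_prop))).div_const c).neg.continuousOn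
  have hder : ∀ y ∈ Ioo (min a c) (max a c),
      HasDerivAt (fun y => -(eF (1 - (a / c) ^ 2) (arccos (X y)) / c))
        (1 / (√(c ^ 2 - y ^ 2) * √(y ^ 2 - a ^ 2))) y := fun y hy => by
    rw [min_eq_left hac.le, max_eq_right hac.le] at hy
    have hy0 : 0 < y := ha.trans hy.1
    have hya : 0 < y ^ 2 - a ^ 2 := by nlinarith [hy.1]
    have hyc : 0 < c ^ 2 - y ^ 2 := by nlinarith [hy.2]
    have hq : 0 < (y ^ 2 - a ^ 2) / (c ^ 2 - a ^ 2) := by positivity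
    have hX0 : 0 < X y := Real.sqrt_pos.2 hq
    have hX2 : X y ^ 2 = (y ^ 2 - a ^ 2) / (c ^ 2 - a ^ 2) := Real.sq_sqrt hq.le
    have hX1' : 1 - X y ^ 2 = (c ^ 2 - y ^ 2) / (c ^ 2 - a ^ 2) := by
      rw [hX2]; field_simp; ring
    have hX1 : X y < 1 := by
      have : 0 < 1 - X y ^ 2 := by rw [hX1']; positivity
      nlinarith
    have hdX : HasDerivAt X (y / ((c ^ 2 - a ^ 2) * X y)) y := by
      have := (((hasDerivAt_pow 2 y).sub_const (a ^ 2)).div_const (c ^ 2 - a ^ 2)).sqrt hq.ne'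
      refine this.congr_deriv ?_
      change _ / (2 * X y) = _
      field_simp
      simp
    have hd := ((((hasDerivAt_eF hm (arccos (X y))).comp y
      ((hasDerivAt_arccos (by linarith : X y ≠ -1) hX1.ne).comp y hdX))).div_const c).neg
    refine hd.congr_deriv ?_
    have hsin : 1 - (1 - (a / c) ^ 2) * sin (arccos (X y)) ^ 2 = (y / c) ^ 2 := by
      rw [sin_arccos, Real.sq_sqrt (by rw [hX1']; positivity), hX1']
      field_simp
      ring
    rw [hsin, Real.sqrt_sq (by positivity), hX1', Real.sqrt_div hyc.le, hX]
    simp only []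
    rw [Real.sqrt_div hya.le]
    have hs := Real.sq_sqrt hca.le
    have h1 := (Real.sqrt_pos.2 hca).ne'
    have h2 := (Real.sqrt_pos.2 hya).ne'
    have h3 := (Real.sqrt_pos.2 hyc).ne'
    field_simp
    exact hs
  rw [intervalIntegral.integral_eq_sub_of_hasDeriv_right hcont
    (fun y hy => (hder y hy).hasDerivWithinAt)
    (intervalIntegral.intervalIntegrable_deriv_of_nonneg hcont hder fun y _ => by positivity)]
  have e1 : X c = 1 := by simp [hX, div_self hca.ne']
  have e2 : X a = 0 := by simp [hX]
  simp only [e1, e2, arccos_one, arccos_zero, eF_zero, eF_pi_div_two]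
  ring

lemma csqrt_ofReal {x : ℝ} (hx : 0 ≤ x) : csqrt x = (√x : ℝ) := by
  rw [csqrt, Real.sqrt_eq_rpow, Complex.ofReal_cpow hx]; norm_num

lemma csqrt_neg_ofReal {x : ℝ} (hx : 0 ≤ x) : csqrt (-x : ℝ) = Complex.I * (√x : ℝ) := by
  rw [csqrt, Complex.ofReal_cpow_of_nonpos (by linarith), ← Complex.ofReal_neg, neg_neg]
  have h := csqrt_ofReal hx
  rw [csqrt] at h
  rw [h, show (π : ℂ) * Complex.I * (1 / 2) = π / 2 * Complex.I by ring,
    Complex.exp_pi_div_two_mul_I, mul_comm]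

lemma I_mul_sq (y : ℝ) : (Complex.I * y) ^ 2 = -(y : ℂ) ^ 2 := by
  rw [mul_pow, Complex.I_sq]; ring

lemma w_imag_of_sq_le {y : ℝ} (hyc : y ^ 2 ≤ c ^ 2) (hya : y ^ 2 ≤ a ^ 2) :
    w c a (Complex.I * y) = (√(c ^ 2 - y ^ 2) * √(a ^ 2 - y ^ 2) : ℝ) := by
  rw [Complex.ofReal_mul, ← csqrt_ofReal (sub_nonneg.2 hyc), ← csqrt_ofReal (sub_nonneg.2 hya),
    w, I_mul_sq]
  push_cast
  congr 2 <;> ring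

lemma w_imag_of_le_sq {y : ℝ} (hyc : y ^ 2 ≤ c ^ 2) (hya : a ^ 2 ≤ y ^ 2) :
    w c a (Complex.I * y) = Complex.I * (√(c ^ 2 - y ^ 2) * √(y ^ 2 - a ^ 2) : ℝ) := by
  rw [Complex.ofReal_mul, ← csqrt_ofReal (sub_nonneg.2 hyc), mul_left_comm,
    ← csqrt_neg_ofReal (sub_nonneg.2 hya), w, I_mul_sq]
  push_cast
  congr 2 <;> ring

lemma segInt_imag (f : ℂ → ℂ) (p q : ℝ) :
    segInt f (Complex.I * p) (Complex.I * q) = Complex.I * ∫ y in p..q, f (Complex.I * y) := by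
  have h := intervalIntegral.smul_integral_comp_mul_add (a := 0) (b := 1)
    (fun y : ℝ => f (Complex.I * y)) (q - p) p
  simp only [mul_zero, zero_add, mul_one, sub_add_cancel] at h
  rw [segInt, ← h, intervalIntegral.integral_mul_const, Complex.real_smul]
  have : ∀ t : ℝ, Complex.I * (p : ℂ) + t * (Complex.I * q - Complex.I * p) =
      Complex.I * (((q - p) * t + p : ℝ) : ℂ) := fun t => by push_cast; ring
  simp only [this]
  push_cast
  ring

lemma integral_one_div_neg (f : ℂ → ℂ) (p q : ℝ) :
    ∫ y in p..q, 1 / -(f (Complex.I * y)) = ∫ y in q..p, 1 / f (Complex.I * y) := by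
  rw [intervalIntegral.integral_symm q p, ← intervalIntegral.integral_neg]
  simp only [div_neg, neg_neg]

lemma aPeriod_eq (ha : 0 < a) (hac : a < c) :
    aPeriod c a = -(4 * Complex.I * eK ((a / c) ^ 2) / c) := by
  have hc := ha.trans hac
  have e : -(Complex.I * (a : ℂ)) = Complex.I * ((-a : ℝ) : ℂ) := by push_cast; ring
  have hI : ∫ y in (-a)..a, 1 / w c a (Complex.I * y) = (2 * eK ((a / c) ^ 2) / c : ℝ) := by
    rw [← integral_aPeriod ha hac, ← intervalIntegral.integral_ofReal]
    refine intervalIntegral.integral_congr fun y hy => ?_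
    rw [uIcc_of_le (by linarith)] at hy
    rw [w_imag_of_sq_le (by nlinarith [hy.1, hy.2]) (by nlinarith [hy.1, hy.2])]
    push_cast; rfl
  rw [aPeriod, e, segInt_imag, segInt_imag, integral_one_div_neg (w c a),
    intervalIntegral.integral_symm (-a) a, hI]
  push_cast; ring

lemma bPeriod_eq (ha : 0 < a) (hac : a < c) :
    bPeriod c a = 2 * eK (1 - (a / c) ^ 2) / c := by
  have hI : ∫ y in a..c, 1 / w c a (Complex.I * y) =
      -Complex.I * (eK (1 - (a / c) ^ 2) / c : ℝ) := by
    rw [← integral_bPeriod ha hac, ← intervalIntegral.integral_ofReal,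
      ← intervalIntegral.integral_const_mul]
    refine intervalIntegral.integral_congr fun y hy => ?_
    rw [uIcc_of_le hac.le] at hy
    rw [w_imag_of_le_sq (by nlinarith [hy.1, hy.2]) (by nlinarith [hy.1, hy.2]), one_div, mul_inv,
      Complex.inv_I]
    push_cast; ring
  rw [bPeriod, segInt_imag, segInt_imag, integral_one_div_neg (w c a), hI]
  push_cast
  linear_combination (-2 * eK (1 - (a / c) ^ 2) / c : ℂ) * Complex.I_sq

lemma eK_ne_zero (ha : 0 < a) (hac : a < c) : (eK ((a / c) ^ 2) : ℂ) ≠ 0 := by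
  exact_mod_cast (eK_pos (div_sq_lt_one ha hac)).ne'

lemma Gam_eq (ha : 0 < a) (hac : a < c) : Gam c a = Complex.I * c / (4 * eK ((a / c) ^ 2)) := by
  have hc : (c : ℂ) ≠ 0 := by exact_mod_cast (ha.trans hac).ne'
  have := eK_ne_zero ha hac
  rw [Gam, aPeriod_eq ha hac]
  generalize (eK ((a / c) ^ 2) : ℂ) = K at *
  have hI := Complex.I_ne_zero
  field_simp
  linear_combination -Complex.I_sq

/-- Here the doubled period matters: `2τ`, not `τ`, is the period ratio belonging to the modulus
`a/c`. -/
lemma two_tau_eq (ha : 0 < a) (hac : a < c) :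
    2 * tau c a = periodRatio ((a / c) ^ 2) * Complex.I := by
  have hc : (c : ℂ) ≠ 0 := by exact_mod_cast (ha.trans hac).ne'
  have := eK_ne_zero ha hac
  rw [tau, Gam_eq ha hac, bPeriod_eq ha hac, periodRatio]
  push_cast
  generalize (eK ((a / c) ^ 2) : ℂ) = K at *
  generalize (eK (1 - (a / c) ^ 2) : ℂ) = K'
  field_simp
  ring

lemma periodRatio_modulus_pos (ha : 0 < a) (hac : a < c) : 0 < periodRatio ((a / c) ^ 2) :=
  periodRatio_pos (div_sq_pos ha hac) (div_sq_lt_one ha hac)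

lemma tau_im_pos (ha : 0 < a) (hac : a < c) : 0 < (tau c a).im := by
  have h := congrArg Complex.im (two_tau_eq ha hac)
  have hr := periodRatio_modulus_pos ha hac
  simp at h
  linarith

end Periods

/-! ### The Abel map -/

section Abel

open Complex Set

/-- A primitive, by radial integration, of a holomorphic function on a domain which is star-shaped
about the origin. -/
lemma hasDerivAt_radial_integral {g : ℂ → ℂ} {D : Set ℂ} (hD : IsOpen D)
    (hstar : ∀ u ∈ D, ∀ t ∈ Icc (0 : ℝ) 1, (t : ℂ) * u ∈ D) (hg : DifferentiableOn ℂ g D)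
    {u : ℂ} (hu : u ∈ D) :
    HasDerivAt (fun u => ∫ t in (0 : ℝ)..1, u * g (t * u)) (g u) u := by
  have hgd : ∀ v ∈ D, HasDerivAt g (deriv g v) v := fun v hv =>
    (hg.differentiableAt (hD.mem_nhds hv)).hasDerivAt
  have hg' : ContinuousOn (deriv g) D := (hg.deriv hD).continuousOn
  have hcont : ContinuousOn (fun p : ℂ × ℝ => g (p.2 * p.1) + p.1 * (deriv g (p.2 * p.1) * p.2))
      (D ×ˢ Icc (0 : ℝ) 1) := by
    have hm : MapsTo (fun p : ℂ × ℝ => (p.2 : ℂ) * p.1) (D ×ˢ Icc (0 : ℝ) 1) D :=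
      fun p hp => hstar p.1 hp.1 p.2 hp.2
    have hc : ContinuousOn (fun p : ℂ × ℝ => (p.2 : ℂ) * p.1) (D ×ˢ Icc (0 : ℝ) 1) := by fun_prop
    exact (hg.continuousOn.comp hc hm).add (ContinuousOn.mul (by fun_prop)
      ((hg'.comp hc hm).mul (by fun_prop)))
  have hcu : ContinuousOn (fun t : ℝ => g (t * u) + u * (deriv g (t * u) * t)) (Icc 0 1) :=
    hcont.comp (f := fun t : ℝ => (u, t)) (by fun_prop) fun t ht => ⟨hu, ht⟩
  have h := hasDerivAt_integral_of_continuousOn (f := fun (u : ℂ) (t : ℝ) => u * g (t * u))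
    (f' := fun u t => g (t * u) + u * (deriv g (t * u) * t)) zero_le_one hD
    (fun x hx => continuousOn_const.mul (hg.continuousOn.comp (by fun_prop)
      fun t ht => hstar x hx t ht))
    (fun x hx t ht => by
      have h1 : HasDerivAt (fun y : ℂ => (t : ℂ) * y) t x := by
        simpa using (hasDerivAt_id x).const_mul (t : ℂ)
      refine ((hasDerivAt_id' x).fun_mul ((hgd _ (hstar x hx t ht)).comp x h1)).congr_deriv ?_
      simp) hcont hu
  refine h.congr_deriv ?_
  -- The differentiated integrand is a total derivative in `t`, so its integral is the boundary
  -- value at `t = 1`.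
  have hd : ∀ t ∈ uIcc (0 : ℝ) 1, HasDerivAt (fun t : ℝ => (t : ℂ) * g (t * u))
      (g (t * u) + u * (deriv g (t * u) * t)) t := fun t ht => by
    rw [uIcc_of_le zero_le_one] at ht
    have h0 : HasDerivAt (fun t : ℝ => (t : ℂ)) 1 t := Complex.ofRealCLM.hasDerivAt
    have h1 := h0.mul ((hgd _ (hstar u hu t ht)).comp t (h0.mul_const u))
    refine h1.congr_deriv ?_
    simp only [Function.comp]
    ring
  rw [intervalIntegral.integral_eq_sub_of_hasDerivAt hd
    (by simpa [uIcc_of_le (zero_le_one' ℝ)] using hcu :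
      ContinuousOn _ (uIcc (0 : ℝ) 1)).intervalIntegrable]
  simp

/-! ### Branches of the square root and the coordinate `1/k`. -/

lemma csqrt_sq (z : ℂ) : csqrt z ^ 2 = z := by
  rw [csqrt, ← Complex.cpow_nat_mul]; simp

lemma csqrt_ne_zero {z : ℂ} (hz : z ∈ slitPlane) : csqrt z ≠ 0 := fun h =>
  slitPlane_ne_zero hz (by rw [← csqrt_sq z, h]; simp)

lemma csqrt_re_pos {z : ℂ} (hz : z ∈ slitPlane) : 0 < (csqrt z).re := by
  have h0 := slitPlane_ne_zero hz
  rw [csqrt, cpow_def_of_ne_zero h0, exp_re]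
  refine mul_pos (Real.exp_pos _) (Real.cos_pos_of_mem_Ioo ?_)
  have him : (log z * (1 / 2)).im = arg z / 2 := by
    rw [show (1 / 2 : ℂ) = ((1 / 2 : ℝ) : ℂ) by push_cast; rfl, im_mul_ofReal, log_im]; ring
  rw [him]
  have h1 := neg_pi_lt_arg z
  have h2 := (mem_slitPlane_iff_arg.1 hz).1
  have h3 := lt_of_le_of_ne (arg_le_pi z) h2
  constructor <;> linarith

lemma differentiableAt_csqrt {z : ℂ} (hz : z ∈ slitPlane) : DifferentiableAt ℂ csqrt z :=
  (hasStrictDerivAt_cpow_const (c := 1 / 2) hz).hasDerivAt.differentiableAt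

lemma one_add_scale_mem_slitPlane {z : ℂ} (hz : 1 + z ∈ slitPlane) {r : ℝ} (h0 : 0 ≤ r)
    (h1 : r ≤ 1) : 1 + (r : ℂ) * z ∈ slitPlane := by
  rcases h0.eq_or_lt with rfl | hr
  · simp
  rw [mem_slitPlane_iff] at hz ⊢
  simp only [add_re, one_re, add_im, one_im, zero_add, re_ofReal_mul, im_ofReal_mul] at hz ⊢
  rcases hz with h | h
  · left; nlinarith
  · right; exact mul_ne_zero hr.ne' h

/-- The plane slit along the two imaginary rays from `±i / c` to infinity: the image under
`k ↦ 1 / k` of the complement of the cut. -/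
def slitDomain (c : ℝ) : Set ℂ := {u | 1 + (c : ℂ) ^ 2 * u ^ 2 ∈ slitPlane}

lemma isOpen_slitDomain (c : ℝ) : IsOpen (slitDomain c) :=
  isOpen_slitPlane.preimage (by fun_prop)

lemma slitDomain_scale {c a : ℝ} (ha : 0 ≤ a) (hac : a ≤ c) {u : ℂ} (hu : u ∈ slitDomain c) :
    u ∈ slitDomain a := by
  rcases (ha.trans hac).eq_or_lt with h | hc
  · simp [slitDomain, show a = 0 by linarith]
  have h := one_add_scale_mem_slitPlane hu (r := (a / c) ^ 2) (by positivity)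
    (by rw [div_pow, div_le_one (by positivity)]; gcongr)
  have hc' : (c : ℂ) ≠ 0 := by exact_mod_cast hc.ne'
  have e : (((a / c) ^ 2 : ℝ) : ℂ) * ((c : ℂ) ^ 2 * u ^ 2) = (a : ℂ) ^ 2 * u ^ 2 := by
    push_cast; field_simp
  rwa [e] at h

lemma slitDomain_star {c : ℝ} {u : ℂ} (hu : u ∈ slitDomain c) {t : ℝ} (ht : t ∈ Icc (0 : ℝ) 1) :
    (t : ℂ) * u ∈ slitDomain c := by
  have h := one_add_scale_mem_slitPlane hu (r := t ^ 2) (by positivity) (by nlinarith [ht.1, ht.2])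
  have e : ((t ^ 2 : ℝ) : ℂ) * ((c : ℂ) ^ 2 * u ^ 2) = (c : ℂ) ^ 2 * (t * u) ^ 2 := by
    push_cast; ring
  rwa [e] at h

/-- The differential `-dk / w` in the coordinate `u = 1 / k` at infinity. -/
def formAtInfty (c a : ℝ) (u : ℂ) : ℂ :=
  (csqrt (1 + (c : ℂ) ^ 2 * u ^ 2) * csqrt (1 + (a : ℂ) ^ 2 * u ^ 2))⁻¹

/-- The integral of `formAtInfty` from `0`. -/
def abelInfty (c a : ℝ) (u : ℂ) : ℂ := ∫ t in (0 : ℝ)..1, u * formAtInfty c a (t * u)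

variable {c a : ℝ}

lemma differentiableOn_formAtInfty (ha : 0 < a) (hac : a < c) :
    DifferentiableOn ℂ (formAtInfty c a) (slitDomain c) := fun u hu => by
  have h1 : 1 + (c : ℂ) ^ 2 * u ^ 2 ∈ slitPlane := hu
  have h2 : 1 + (a : ℂ) ^ 2 * u ^ 2 ∈ slitPlane := slitDomain_scale ha.le hac.le hu
  have d1 : DifferentiableAt ℂ (fun u : ℂ => csqrt (1 + (c : ℂ) ^ 2 * u ^ 2)) u :=
    DifferentiableAt.comp (f := fun u : ℂ => 1 + (c : ℂ) ^ 2 * u ^ 2) u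
      (differentiableAt_csqrt h1) (by fun_prop)
  have d2 : DifferentiableAt ℂ (fun u : ℂ => csqrt (1 + (a : ℂ) ^ 2 * u ^ 2)) u :=
    DifferentiableAt.comp (f := fun u : ℂ => 1 + (a : ℂ) ^ 2 * u ^ 2) u
      (differentiableAt_csqrt h2) (by fun_prop)
  exact ((d1.mul d2).inv (mul_ne_zero (csqrt_ne_zero h1)
    (csqrt_ne_zero h2))).differentiableWithinAt

lemma hasDerivAt_abelInfty (ha : 0 < a) (hac : a < c) {u : ℂ} (hu : u ∈ slitDomain c) :
    HasDerivAt (abelInfty c a) (formAtInfty c a u) u :=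
  hasDerivAt_radial_integral (isOpen_slitDomain c) (fun _ hu _ ht => slitDomain_star hu ht)
    (differentiableOn_formAtInfty ha hac) hu

lemma mem_cut_iff (hc : 0 < c) {k : ℂ} : k ∈ cut c ↔ k.re = 0 ∧ -c ≤ k.im ∧ k.im ≤ c := by
  constructor
  · rintro ⟨p, q, hp, hq, hpq, rfl⟩
    simp
    constructor <;> nlinarith
  · rintro ⟨h1, h2, h3⟩
    refine ⟨(1 + k.im / c) / 2, (1 - k.im / c) / 2, ?_, ?_, by ring, ?_⟩
    · have : -1 ≤ k.im / c := by rw [le_div_iff₀ hc]; linarith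
      linarith
    · have : k.im / c ≤ 1 := by rw [div_le_iff₀ hc]; linarith
      linarith
    · apply Complex.ext
      · simp [h1]
      · simp
        field_simp
        ring

lemma ne_zero_of_notMem_cut (hc : 0 < c) {k : ℂ} (hk : k ∉ cut c) : k ≠ 0 := by
  rintro rfl
  exact hk ((mem_cut_iff hc).2 ⟨rfl, by simpa using hc.le, by simpa using hc.le⟩)

/-- If `1 + c²/k² = r ≤ 0`, then `k² = -c²/(1 - r)`, so `k` is imaginary of modulus at most `c`. -/
lemma inv_mem_slitDomain (hc : 0 < c) {k : ℂ} (hk : k ∉ cut c) : k⁻¹ ∈ slitDomain c := by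
  have h0 := ne_zero_of_notMem_cut hc hk
  by_contra hmem
  apply hk
  simp only [slitDomain, mem_ofPred_eq, mem_slitPlane_iff, not_or, not_lt, not_not] at hmem
  obtain ⟨hre, him⟩ := hmem
  set r := (1 + (c : ℂ) ^ 2 * k⁻¹ ^ 2).re with hr
  have hz : 1 + (c : ℂ) ^ 2 * k⁻¹ ^ 2 = r := Complex.ext (ofReal_re r).symm (by rw [him, ofReal_im])
  have hk2 : (c : ℂ) ^ 2 = ((r - 1 : ℝ) : ℂ) * k ^ 2 := by
    have : (c : ℂ) ^ 2 * k⁻¹ ^ 2 = ((r - 1 : ℝ) : ℂ) := by push_cast; linear_combination hz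
    rw [← this]; field_simp
  have e1 := congrArg Complex.re hk2
  have e2 := congrArg Complex.im hk2
  rw [re_ofReal_mul, ← ofReal_pow, ofReal_re, sq k, mul_re] at e1
  rw [im_ofReal_mul, ← ofReal_pow, ofReal_im, sq k, mul_im] at e2
  have hr1 : r - 1 ≠ 0 := by linarith
  have e3 : k.re * k.im = 0 := by
    have := (mul_eq_zero.1 e2.symm).resolve_left hr1
    linarith
  have hcsq : 0 < c ^ 2 := by positivity
  have hre0 : k.re = 0 := by
    rcases mul_eq_zero.1 e3 with h | h
    · exact h
    · rw [h] at e1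
      nlinarith [sq_nonneg k.re]
  rw [hre0] at e1
  have h2 : k.im ^ 2 ≤ c ^ 2 := by nlinarith [sq_nonneg k.im]
  have := abs_le.1 (abs_le_of_sq_le_sq h2 hc.le)
  exact (mem_cut_iff hc).2 ⟨hre0, this.1, this.2⟩

lemma eq_of_sq_eq_of_re_pos {x y : ℂ} (h : x ^ 2 = y ^ 2) (hx : 0 < x.re) (hy : 0 < y.re) :
    x = y := by
  rcases sq_eq_sq_iff_eq_or_eq_neg.1 h with h | h
  · exact h
  · rw [h, neg_re] at hx; linarith

/-- Both sides have the same square, so it suffices that both have positive real part. For the right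
side `k s`, `Im k · Im s ≤ 0` since `Im s²` has sign opposite to `Re k · Im k`; hence `Re (k s) ≥ Re
k · Re s > 0`. -/
lemma csqrt_sq_add_of_re_pos (hc : 0 ≤ c) {k : ℂ} (hk : 0 < k.re) :
    csqrt (k ^ 2 + (c : ℂ) ^ 2) = k * csqrt (1 + (c : ℂ) ^ 2 * k⁻¹ ^ 2) := by
  have hk0 : k ≠ 0 := fun h => by simp [h] at hk
  have hcut : k⁻¹ ∈ slitDomain c := by
    rcases hc.eq_or_lt with rfl | hc
    · simp [slitDomain]
    · exact inv_mem_slitDomain hc fun h => hk.ne' ((mem_cut_iff hc).1 h).1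
  have hs := csqrt_re_pos hcut
  have hs2 := csqrt_sq (1 + (c : ℂ) ^ 2 * k⁻¹ ^ 2)
  set s := csqrt (1 + (c : ℂ) ^ 2 * k⁻¹ ^ 2) with hsdef
  have hsq : (k * s) ^ 2 = k ^ 2 + (c : ℂ) ^ 2 := by rw [mul_pow, hs2]; field_simp
  have hslit : k ^ 2 + (c : ℂ) ^ 2 ∈ slitPlane := by
    rw [mem_slitPlane_iff, ← ofReal_pow, add_re, add_im, ofReal_re, ofReal_im, sq k, mul_re, mul_im]
    by_cases him : k.im = 0
    · left; rw [him]; nlinarith [sq_nonneg c]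
    · right
      have := mul_ne_zero hk.ne' him
      intro h
      apply this
      linarith
  refine eq_of_sq_eq_of_re_pos (by rw [csqrt_sq, hsq]) (csqrt_re_pos hslit) ?_
  have him := congrArg Complex.im hs2
  have e : (1 + (c : ℂ) ^ 2 * k⁻¹ ^ 2).im =
      -(c ^ 2 * (2 * (k.re * k.im)) / normSq k ^ 2) := by
    rw [add_im, one_im, zero_add, ← ofReal_pow, im_ofReal_mul, sq k⁻¹, mul_im, inv_re, inv_im]
    ring
  rw [e, sq s, mul_im] at him
  have hn : 0 < normSq k := normSq_pos.2 hk0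
  have hle : s.re * (k.im * s.im) ≤ 0 := by
    have : s.re * (k.im * s.im) = -(c ^ 2 * k.re * k.im ^ 2 / normSq k ^ 2) := by
      have : s.re * (k.im * s.im) = k.im * (s.re * s.im + s.im * s.re) / 2 := by ring
      rw [this, him]; ring
    rw [this]
    have : 0 ≤ c ^ 2 * k.re * k.im ^ 2 / normSq k ^ 2 := by positivity
    linarith
  have hle2 : k.im * s.im ≤ 0 := by
    by_contra hcon
    push Not at hcon
    nlinarith [mul_pos hs hcon]
  rw [mul_re]
  nlinarith [mul_pos hk hs]

/-- Here `k² + c²` lies on the cut of `csqrt`, so the real-part argument fails; the value `i √(y² -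
c²)` that `csqrt` takes there is compared directly. -/
lemma csqrt_sq_add_of_imag {y : ℝ} (hc : 0 ≤ c) (hy : c < y) :
    csqrt ((I * y) ^ 2 + (c : ℂ) ^ 2) =
      I * y * csqrt (1 + (c : ℂ) ^ 2 * (I * (y : ℂ))⁻¹ ^ 2) := by
  have hy0 : 0 < y := hc.trans_lt hy
  have hyc : (y : ℂ) ≠ 0 := by exact_mod_cast hy0.ne'
  have e1 : (I * (y : ℂ)) ^ 2 + (c : ℂ) ^ 2 = (-(y ^ 2 - c ^ 2) : ℝ) := by
    rw [I_mul_sq]; push_cast; ring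
  have e2 : 1 + (c : ℂ) ^ 2 * (I * (y : ℂ))⁻¹ ^ 2 = (((y ^ 2 - c ^ 2) / y ^ 2 : ℝ) : ℂ) := by
    rw [inv_pow, I_mul_sq]; push_cast; field_simp; ring
  have h0 : 0 ≤ y ^ 2 - c ^ 2 := by nlinarith
  rw [e1, e2, csqrt_neg_ofReal h0, csqrt_ofReal (by positivity), Real.sqrt_div h0,
    Real.sqrt_sq hy0.le]
  push_cast
  field_simp

lemma w_neg (k : ℂ) : w c a (-k) = w c a k := by simp [w]

lemma notMem_cut_neg (hc : 0 < c) {k : ℂ} (hk : k ∉ cut c) : -k ∉ cut c := fun h => hk (by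
  rw [mem_cut_iff hc] at h ⊢
  simp only [neg_re, neg_im] at h
  exact ⟨by linarith, by linarith, by linarith⟩)

/-- The behaviour of `w` in the coordinate `1 / k`. -/
lemma w_eq_of_notMem_cut (ha : 0 < a) (hac : a < c) {k : ℂ} (hk : k ∉ cut c) :
    w c a k = k ^ 2 *
      (csqrt (1 + (c : ℂ) ^ 2 * k⁻¹ ^ 2) * csqrt (1 + (a : ℂ) ^ 2 * k⁻¹ ^ 2)) := by
  have hc := ha.trans hac
  have key : ∀ k : ℂ, k ∉ cut c → (0 < k.re ∨ k.re = 0 ∧ 0 < k.im) → w c a k = k ^ 2 *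
      (csqrt (1 + (c : ℂ) ^ 2 * k⁻¹ ^ 2) * csqrt (1 + (a : ℂ) ^ 2 * k⁻¹ ^ 2)) := by
    rintro k hk (h | ⟨h, him⟩)
    · rw [w, csqrt_sq_add_of_re_pos hc.le h, csqrt_sq_add_of_re_pos ha.le h]; ring
    · have hkI : k = I * (k.im : ℂ) := Complex.ext (by simp [h]) (by simp)
      have hy : c < k.im := by
        by_contra hcon
        push Not at hcon
        exact hk ((mem_cut_iff hc).2 ⟨h, by linarith, hcon⟩)
      rw [hkI, w, csqrt_sq_add_of_imag hc.le hy, csqrt_sq_add_of_imag ha.le (hac.trans hy)]; ring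
  -- Both sides are even in `k`, and one of `k`, `-k` is covered by `key`.
  by_cases h : 0 < k.re ∨ k.re = 0 ∧ 0 < k.im
  · exact key k hk h
  · have h0 := ne_zero_of_notMem_cut hc hk
    have h' : 0 < (-k).re ∨ (-k).re = 0 ∧ 0 < (-k).im := by
      simp only [not_or, not_lt, not_and, neg_re, neg_im] at h ⊢
      rcases h.1.eq_or_lt with h1 | h1
      · refine Or.inr ⟨by linarith, ?_⟩
        rcases (h.2 h1).eq_or_lt with h2 | h2
        · exact absurd (Complex.ext h1 h2) h0
        · linarith
      · left; linarith
    have := key (-k) (notMem_cut_neg hc hk) h'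
    rw [w_neg] at this
    rw [this]; simp [inv_neg]

lemma one_div_w_eq (ha : 0 < a) (hac : a < c) {k : ℂ} (hk : k ∉ cut c) :
    1 / w c a k = formAtInfty c a k⁻¹ * (k ^ 2)⁻¹ := by
  rw [w_eq_of_notMem_cut ha hac hk, formAtInfty, one_div, mul_inv, mul_comm]

lemma hasDerivAt_neg_abelInfty_inv (ha : 0 < a) (hac : a < c) {k : ℂ} (hk : k ∉ cut c) :
    HasDerivAt (fun k => -abelInfty c a k⁻¹) (1 / w c a k) k := by
  have hc := ha.trans hac
  have h0 := ne_zero_of_notMem_cut hc hk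
  have := ((hasDerivAt_abelInfty ha hac (inv_mem_slitDomain hc hk)).comp k (hasDerivAt_inv h0)).neg
  refine this.congr_deriv ?_
  rw [one_div_w_eq ha hac hk]; ring

lemma continuousOn_one_div_w (ha : 0 < a) (hac : a < c) :
    ContinuousOn (fun k => 1 / w c a k) (cut c)ᶜ := by
  have hc := ha.trans hac
  have h : ContinuousOn (fun k : ℂ => formAtInfty c a k⁻¹ * (k ^ 2)⁻¹) (cut c)ᶜ := by
    have hinv : ContinuousOn (fun k : ℂ => k⁻¹) (cut c)ᶜ :=
      continuousOn_inv₀.mono fun k hk => ne_zero_of_notMem_cut hc hk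
    refine ((differentiableOn_formAtInfty ha hac).continuousOn.comp hinv
      fun k hk => inv_mem_slitDomain hc hk).mul ?_
    exact (continuousOn_id.pow 2).inv₀ fun k hk => pow_ne_zero 2 (ne_zero_of_notMem_cut hc hk)
  exact h.congr fun k hk => one_div_w_eq ha hac hk

/-- At `u = -i sin ψ / c` the form becomes `-i/c` times the Legendre integrand, so the difference of
the two sides has zero derivative. -/
lemma abelInfty_sin (ha : 0 < a) (hac : a < c) {φ : ℝ} (h0 : 0 ≤ φ) (h1 : φ < Real.pi / 2) :
    abelInfty c a (-I * Real.sin φ / c) = -I / c * eF ((a / c) ^ 2) φ := by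
  have hc := ha.trans hac
  have hcC : (c : ℂ) ≠ 0 := by exact_mod_cast hc.ne'
  have hm := div_sq_lt_one ha hac
  have hder : ∀ ψ ∈ Ico 0 (Real.pi / 2), HasDerivAt (fun ψ : ℝ =>
      abelInfty c a (-I * Real.sin ψ / c) - -I / c * eF ((a / c) ^ 2) ψ) 0 ψ := fun ψ hψ => by
    have hcos : 0 < Real.cos ψ :=
      Real.cos_pos_of_mem_Ioo ⟨by linarith [Real.pi_pos, hψ.1], hψ.2⟩
    have hsq : ∀ x : ℝ, 1 + (x : ℂ) ^ 2 * (-I * Real.sin ψ / c) ^ 2 =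
        ((1 - (x / c) ^ 2 * Real.sin ψ ^ 2 : ℝ) : ℂ) := fun x => by
      rw [div_pow, mul_pow, neg_sq, I_sq]; push_cast; field_simp; ring
    have hone : 1 - (c / c) ^ 2 * Real.sin ψ ^ 2 = Real.cos ψ ^ 2 := by
      rw [div_self hc.ne']; linarith [Real.sin_sq_add_cos_sq ψ]
    have hmem : -I * Real.sin ψ / c ∈ slitDomain c := by
      rw [slitDomain, mem_ofPred_eq, hsq, hone]
      exact ofReal_mem_slitPlane.2 (by positivity)
    have h1 := (hasDerivAt_abelInfty ha hac hmem).comp ψ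
      ((((Real.hasDerivAt_sin ψ).ofReal_comp).const_mul (-I)).div_const (c : ℂ))
    have h2 := ((hasDerivAt_eF hm ψ).ofReal_comp).const_mul (-I / c : ℂ)
    refine (h1.sub h2).congr_deriv ?_
    rw [formAtInfty, hsq, hsq, hone, csqrt_ofReal (by positivity), Real.sqrt_sq hcos.le,
      csqrt_ofReal (delta_pos hm ψ).le]
    have e1 : (Real.cos ψ : ℂ) ≠ 0 := by exact_mod_cast hcos.ne'
    have e2 : (√(1 - (a / c) ^ 2 * Real.sin ψ ^ 2) : ℂ) ≠ 0 := by
      exact_mod_cast (sqrt_delta_pos hm ψ).ne'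
    rw [ofReal_div, ofReal_one, mul_inv]
    generalize (√(1 - (a / c) ^ 2 * Real.sin ψ ^ 2) : ℂ) = D at *
    field_simp
    ring
  have := constant_of_has_deriv_right_zero (a := 0) (b := φ)
    (fun ψ hψ => (hder ψ ⟨hψ.1, hψ.2.trans_lt h1⟩).continuousAt.continuousWithinAt)
    (fun ψ hψ => (hder ψ ⟨hψ.1, hψ.2.trans h1⟩).hasDerivWithinAt) φ ⟨h0, le_rfl⟩
  have hz : abelInfty c a (-I * Real.sin 0 / c) - -I / c * eF ((a / c) ^ 2) 0 = 0 := by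
    simp [eF_zero, abelInfty]
  rw [hz] at this
  exact sub_eq_zero.1 this

/-! ### The Abel integral at the branch point `ic`. -/

lemma w_sq (k : ℂ) : w c a k ^ 2 = (k - I * c) * ((k + I * c) * (k ^ 2 + (a : ℂ) ^ 2)) := by
  rw [w, mul_pow, csqrt_sq, csqrt_sq]
  linear_combination ((c : ℂ) ^ 2 * (k ^ 2 + (a : ℂ) ^ 2)) * I_sq

lemma norm_one_div_w_le {κ : ℝ} (hκ : 0 < κ) {k : ℂ} (hk : k ≠ I * c)
    (h : κ ≤ ‖(k + I * c) * (k ^ 2 + (a : ℂ) ^ 2)‖) :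
    ‖1 / w c a k‖ ≤ 1 / √(κ * ‖k - I * c‖) := by
  have hpos : 0 < ‖k - I * c‖ := norm_pos_iff.2 (sub_ne_zero.2 hk)
  rw [norm_div, norm_one]
  refine one_div_le_one_div_of_le (Real.sqrt_pos.2 (by positivity)) (Real.sqrt_le_iff.2
    ⟨norm_nonneg _, ?_⟩)
  rw [← norm_pow, w_sq, norm_mul, mul_comm]
  gcongr

lemma branch_factor_ne_zero (ha : 0 < a) (hac : a < c) :
    (I * c + I * c) * ((I * (c : ℂ)) ^ 2 + (a : ℂ) ^ 2) ≠ 0 := by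
  have hc := ha.trans hac
  have e : (I * c + I * c) * ((I * (c : ℂ)) ^ 2 + (a : ℂ) ^ 2) =
      I * ((2 * c * (a ^ 2 - c ^ 2) : ℝ) : ℂ) := by
    rw [I_mul_sq]; push_cast; ring
  rw [e]
  refine mul_ne_zero I_ne_zero (ofReal_ne_zero.2 (mul_ne_zero (by positivity) ?_))
  nlinarith

/-- Points close to the branch point `ic` in a direction other than straight down. -/
lemma notMem_cut_add (hc : 0 < c) {d : ℂ} (hd : ¬ (d.re = 0 ∧ d.im ≤ 0)) {t : ℝ} (ht : 0 < t) :
    I * c + t * d ∉ cut c := fun h => hd (by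
  obtain ⟨h1, -, h3⟩ := (mem_cut_iff hc).1 h
  simp [ht.ne'] at h1 h3
  exact ⟨h1, by nlinarith⟩)

lemma direction_segment {d e : ℂ} (hd : ¬ (d.re = 0 ∧ d.im ≤ 0)) (he : e ∈ segment ℝ I d) :
    ¬ (e.re = 0 ∧ e.im ≤ 0) := by
  obtain ⟨p, q, hp, hq, hpq, rfl⟩ := he
  simp
  intro h
  rcases h with rfl | h
  · linarith
  · have hd' : 0 < d.im := by
      by_contra hcon
      exact hd ⟨h, not_lt.1 hcon⟩
    rcases hp.eq_or_lt with rfl | hp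
    · rw [zero_add] at hpq; rw [hpq]; linarith
    · positivity

/-- Straight above `ic` the integral is explicit by `abelInfty_sin` with `sin φ = c/(c + ε)`, and `φ
→ π/2`. -/
lemma tendsto_abelInfty_up (ha : 0 < a) (hac : a < c) :
    Tendsto (fun ε : ℝ => abelInfty c a (I * c + ε * I)⁻¹) (𝓝[>] 0)
      (𝓝 (-I / c * eK ((a / c) ^ 2))) := by
  have hc := ha.trans hac
  have hm := div_sq_lt_one ha hac
  have hcont : ContinuousAt
      (fun ε : ℝ => (-I / c * eF ((a / c) ^ 2) (Real.arcsin (c / (c + ε))) : ℂ)) 0 := by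
    have h1 : ContinuousAt (fun ε : ℝ => c / (c + ε)) 0 :=
      ContinuousAt.div (by fun_prop) (by fun_prop) (by simpa using hc.ne')
    have h2 := ((continuous_eF hm).comp Real.continuous_arcsin).continuousAt.comp h1
    exact continuousAt_const.mul (Complex.continuous_ofReal.continuousAt.comp h2)
  have h := hcont.tendsto.mono_left (nhdsWithin_le_nhds (s := Ioi 0))
  simp only [add_zero, div_self hc.ne', Real.arcsin_one, eF_pi_div_two] at h
  refine h.congr' ?_
  filter_upwards [self_mem_nhdsWithin] with ε (hε : 0 < ε)
  have hlt : c / (c + ε) < 1 := by rw [div_lt_one (by positivity)]; linarith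
  have hpos : 0 < c / (c + ε) := by positivity
  rw [← abelInfty_sin ha hac (Real.arcsin_nonneg.2 hpos.le) (Real.arcsin_lt_pi_div_two.2 hlt),
    Real.sin_arcsin (by linarith) hlt.le]
  congr 1
  have h1 : (c : ℂ) ≠ 0 := by exact_mod_cast hc.ne'
  have h2 : (c : ℂ) + ε ≠ 0 := by exact_mod_cast (by positivity : c + ε ≠ 0)
  have hI := I_ne_zero
  rw [show I * (c : ℂ) + ε * I = I * (c + ε) by ring]
  push_cast
  field_simp
  linear_combination -I_sq

/-- Comparison with the vertical direction: the segment joining the two points has length `O(ε)` and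
avoids the cut, while `1/w = O(ε^(-1/2))` on it, so the values differ by `O(√ε)`. -/
lemma tendsto_abelInfty_branch (ha : 0 < a) (hac : a < c) {d : ℂ}
    (hd : ¬ (d.re = 0 ∧ d.im ≤ 0)) :
    Tendsto (fun ε : ℝ => abelInfty c a (I * c + ε * d)⁻¹) (𝓝[>] 0)
      (𝓝 (-I / c * eK ((a / c) ^ 2))) := by
  have hc := ha.trans hac
  have hcomp : IsCompact (segment ℝ I d) := by
    rw [segment_eq_image]
    exact isCompact_Icc.image (by fun_prop)
  obtain ⟨e₁, he₁, hmin⟩ := hcomp.exists_isMinOn ⟨I, left_mem_segment ℝ I d⟩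
    continuous_norm.continuousOn
  have he₁pos : 0 < ‖e₁‖ := norm_pos_iff.2 fun h => direction_segment hd he₁ (by simp [h])
  obtain ⟨M, hM⟩ := hcomp.isBounded.exists_norm_le
  set q := ‖(I * c + I * c) * ((I * (c : ℂ)) ^ 2 + (a : ℂ) ^ 2)‖ with hq
  have hqpos : 0 < q := norm_pos_iff.2 (branch_factor_ne_zero ha hac)
  have hcontq : ContinuousAt (fun k : ℂ => ‖(k + I * c) * (k ^ 2 + (a : ℂ) ^ 2)‖) (I * c) := by
    fun_prop
  obtain ⟨ρ, hρ, hball⟩ := Metric.eventually_nhds_iff.1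
    (hcontq.eventually (lt_mem_nhds (half_lt_self hqpos)))
  have hM0 : 0 ≤ M := (norm_nonneg _).trans (hM I (left_mem_segment ℝ I d))
  have hbound : ∀ᶠ ε : ℝ in 𝓝[>] 0, ‖abelInfty c a (I * c + ε * d)⁻¹ -
      abelInfty c a (I * c + ε * I)⁻¹‖ ≤ √ε * (1 / √(q / 2 * ‖e₁‖) * ‖d - I‖) := by
    filter_upwards [Ioo_mem_nhdsGT (by positivity : 0 < ρ / (M + 1))] with ε hε
    have hε0 : 0 < ε := hε.1
    have hεM : ε * M < ρ := by
      have := (lt_div_iff₀ (by positivity : 0 < M + 1)).1 hε.2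
      nlinarith
    have hseg : ∀ k ∈ segment ℝ (I * c + ε * I) (I * c + ε * d),
        ∃ e ∈ segment ℝ I d, k = I * c + ε * e := by
      rintro k ⟨p, r, hp, hr, hpr, rfl⟩
      refine ⟨p • I + r • d, ⟨p, r, hp, hr, hpr, rfl⟩, ?_⟩
      have : (p : ℂ) + r = 1 := by exact_mod_cast hpr
      simp only [real_smul]
      linear_combination I * c * this
    have hmv := (convex_segment (𝕜 := ℝ) (I * c + ε * I) (I * c + ε * d)
      ).norm_image_sub_le_of_norm_hasDerivWithin_le (f := fun k => -abelInfty c a k⁻¹)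
      (f' := fun k => 1 / w c a k) (C := 1 / √(q / 2 * (ε * ‖e₁‖)))
      (fun k hk => by
        obtain ⟨e, he, rfl⟩ := hseg k hk
        exact (hasDerivAt_neg_abelInfty_inv ha hac
          (notMem_cut_add hc (direction_segment hd he) hε0)).hasDerivWithinAt)
      (fun k hk => by
        obtain ⟨e, he, rfl⟩ := hseg k hk
        have he0 : e ≠ 0 := fun h => direction_segment hd he (by simp [h])
        have hne : I * c + ε * e ≠ I * c := by simpa using ⟨hε0.ne', he0⟩
        have hdist : ‖I * c + ε * e - I * c‖ = ε * ‖e‖ := by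
          rw [add_sub_cancel_left, norm_mul, Complex.norm_of_nonneg hε0.le]
        have hlow := hball (y := I * c + ε * e) (by
          rw [dist_eq_norm, hdist]
          exact (mul_le_mul_of_nonneg_left (hM e he) hε0.le).trans_lt hεM)
        refine (norm_one_div_w_le (by positivity) hne hlow.le).trans ?_
        rw [hdist]
        have := hmin he
        simp only [mem_ofPred_eq] at this
        gcongr)
      (left_mem_segment ℝ _ _) (right_mem_segment ℝ _ _)
    rw [neg_sub_neg, ← norm_neg, neg_sub] at hmv
    refine hmv.trans (le_of_eq ?_)
    have e1 : I * (c : ℂ) + ε * d - (I * c + ε * I) = ε * (d - I) := by ring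
    rw [e1, norm_mul, Complex.norm_of_nonneg hε0.le, mul_left_comm (q / 2) ε, Real.sqrt_mul hε0.le]
    have hs := Real.mul_self_sqrt hε0.le
    have hs0 := (Real.sqrt_pos.2 hε0).ne'
    field_simp
    rw [sq, hs]
  have hz : Tendsto (fun ε : ℝ => abelInfty c a (I * c + ε * d)⁻¹ -
      abelInfty c a (I * c + ε * I)⁻¹) (𝓝[>] 0) (𝓝 0) := by
    refine squeeze_zero_norm' hbound ?_
    have : Continuous fun ε : ℝ => √ε * (1 / √(q / 2 * ‖e₁‖) * ‖d - I‖) := by fun_prop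
    have := (this.tendsto 0).mono_left (nhdsWithin_le_nhds (s := Ioi 0))
    simpa using this
  simpa using hz.add (tendsto_abelInfty_up ha hac)

/-- The only singularity is at `t = 0`; compactness bounds the remaining factors of `w²` away from
`0`, leaving a majorant proportional to `t^(-1/2)`. -/
lemma intervalIntegrable_one_div_w (ha : 0 < a) (hac : a < c) {d : ℂ}
    (hd : ¬ (d.re = 0 ∧ d.im ≤ 0)) :
    IntervalIntegrable (fun t : ℝ => 1 / w c a (I * c + t * d) * d) MeasureTheory.volume 0 1 := by
  have hc := ha.trans hac
  have hd0 : d ≠ 0 := fun h => hd (by simp [h])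
  have hfac : ∀ t ∈ Icc (0 : ℝ) 1, (I * c + t * d + I * c) *
      ((I * (c : ℂ) + t * d) ^ 2 + (a : ℂ) ^ 2) ≠ 0 := fun t ht => by
    rcases ht.1.eq_or_lt with rfl | ht0
    · simpa using branch_factor_ne_zero ha hac
    · have hk := notMem_cut_add hc hd ht0
      set k := I * c + t * d
      have key : ∀ y : ℝ, -c ≤ y → y ≤ c → k - I * y ≠ 0 := fun y h1 h2 h => hk (by
        rw [sub_eq_zero.1 h]
        exact (mem_cut_iff hc).2 ⟨by simp, by simpa using h1, by simpa using h2⟩)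
      have e : (k + I * c) * (k ^ 2 + (a : ℂ) ^ 2) =
          (k - I * ((-c : ℝ) : ℂ)) * ((k - I * a) * (k - I * ((-a : ℝ) : ℂ))) := by
        push_cast
        linear_combination (k + I * c) * (a : ℂ) ^ 2 * I_sq
      rw [e]
      exact mul_ne_zero (key _ le_rfl (by linarith)) (mul_ne_zero (key _ (by linarith) hac.le)
        (key _ (by linarith) (by linarith)))
  obtain ⟨t₀, ht₀, hmin⟩ := isCompact_Icc.exists_isMinOn (nonempty_Icc.2 (zero_le_one' ℝ))
    (f := fun t : ℝ => ‖(I * c + t * d + I * c) * ((I * (c : ℂ) + t * d) ^ 2 + (a : ℂ) ^ 2)‖)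
    (Continuous.continuousOn (by fun_prop))
  set κ := ‖(I * c + t₀ * d + I * c) * ((I * (c : ℂ) + t₀ * d) ^ 2 + (a : ℂ) ^ 2)‖ with hκ
  have hκ0 : 0 < κ := norm_pos_iff.2 (hfac t₀ ht₀)
  have hrpow := ((intervalIntegral.intervalIntegrable_rpow' (a := 0) (b := 1)
    (by norm_num : (-1 : ℝ) < -(1 / 2))).const_mul (1 / √(κ * ‖d‖) * ‖d‖))
  refine hrpow.mono_fun' ?_ ?_
  · rw [uIoc_of_le zero_le_one]
    refine ContinuousOn.aestronglyMeasurable ?_ measurableSet_Ioc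
    refine ContinuousOn.mul ((continuousOn_one_div_w ha hac).comp (by fun_prop)
      fun t ht => notMem_cut_add hc hd ht.1) continuousOn_const
  · rw [uIoc_of_le zero_le_one]
    filter_upwards [MeasureTheory.ae_restrict_mem measurableSet_Ioc] with t ht
    have ht0 : 0 < t := ht.1
    have hne : I * c + t * d ≠ I * c := by simpa using ⟨ht0.ne', hd0⟩
    have h := norm_one_div_w_le hκ0 hne (hmin ⟨ht.1.le, ht.2⟩)
    rw [add_sub_cancel_left, norm_mul (t : ℂ), Complex.norm_of_nonneg ht0.le] at h
    rw [norm_mul]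
    refine (mul_le_mul_of_nonneg_right h (norm_nonneg _)).trans (le_of_eq ?_)
    rw [Real.rpow_neg ht0.le, ← Real.sqrt_eq_rpow, mul_left_comm, Real.sqrt_mul ht0.le]
    simp only [one_div, mul_inv]
    ring

lemma segInt_from_branch (ha : 0 < a) (hac : a < c) {z : ℂ} (hz : ¬ (z.re = 0 ∧ z.im ≤ c)) :
    segInt (fun ζ => 1 / w c a ζ) (I * c) z =
      -I / c * eK ((a / c) ^ 2) - abelInfty c a z⁻¹ := by
  have hc := ha.trans hac
  set d := z - I * c with hd
  have hd' : ¬ (d.re = 0 ∧ d.im ≤ 0) := by simpa [hd] using hz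
  have hder (t : ℝ) (ht : 0 < t) : HasDerivAt (fun t : ℝ => -abelInfty c a (I * c + t * d)⁻¹)
      (1 / w c a (I * c + t * d) * d) t := by
    have h0 : HasDerivAt (fun t : ℝ => I * c + (t : ℂ) * d) (1 * d) t :=
      (Complex.ofRealCLM.hasDerivAt.mul_const d).const_add _
    rw [one_mul] at h0
    exact HasDerivAt.comp (h₂ := fun k => -abelInfty c a k⁻¹) t
      (hasDerivAt_neg_abelInfty_inv ha hac (notMem_cut_add hc hd' ht)) h0
  have h := intervalIntegral.integral_eq_sub_of_hasDerivAt_of_tendsto zero_lt_one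
    (fun t ht => hder t ht.1) (intervalIntegrable_one_div_w ha hac hd')
    (tendsto_abelInfty_branch ha hac hd').neg
    ((hder 1 one_pos).continuousAt.tendsto.mono_left nhdsWithin_le_nhds)
  rw [segInt, h]
  simp only [hd, ofReal_one, one_mul, add_sub_cancel]
  ring

/-- The Abel map off the cut through the integral from infinity. -/
lemma abel_eq (ha : 0 < a) (hac : a < c) {k : ℂ} (hk : k ∉ cut c) :
    abel c a k = 1 / 4 - Gam c a * abelInfty c a k⁻¹ := by
  have hc := ha.trans hac
  -- This constant is `A(∞)`: the path from `ic` to infinity contributes a quarter of the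
  -- `a`-period.
  have hGL : Gam c a * (-I / c * eK ((a / c) ^ 2)) = 1 / 4 := by
    rw [Gam_eq ha hac]
    have h1 := eK_ne_zero ha hac
    have h2 : (c : ℂ) ≠ 0 := by exact_mod_cast hc.ne'
    generalize (eK ((a / c) ^ 2) : ℂ) = K at *
    field_simp
    linear_combination -I_sq
  rw [abel]
  split_ifs with h
  · rw [segInt_from_branch ha hac (z := (c : ℂ)) (by simp [hc.ne'])]
    -- As `k` is imaginary, this segment meets the imaginary axis only at its endpoint `k`.
    have hpath : ∀ t ∈ Icc (0 : ℝ) 1, (c : ℂ) + t * (k - c) ∉ cut c := fun t ht hmem => by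
      obtain ⟨h1, -⟩ := (mem_cut_iff hc).1 hmem
      simp [h.1] at h1
      have : t = 1 := by
        have : c * (1 - t) = 0 := by linarith
        have := (mul_eq_zero.1 this).resolve_left hc.ne'
        linarith
      rw [this] at hmem
      apply hk
      simpa using hmem
    have hseg : segInt (fun ζ => 1 / w c a ζ) c k =
        -abelInfty c a k⁻¹ - -abelInfty c a (c : ℂ)⁻¹ := by
      have hder (t : ℝ) (ht : t ∈ uIcc (0 : ℝ) 1) :
          HasDerivAt (fun t : ℝ => -abelInfty c a ((c : ℂ) + t * (k - c))⁻¹)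
            (1 / w c a ((c : ℂ) + t * (k - c)) * (k - c)) t := by
        rw [uIcc_of_le zero_le_one] at ht
        have h0 : HasDerivAt (fun t : ℝ => (c : ℂ) + (t : ℂ) * (k - c)) (1 * (k - c)) t :=
          (Complex.ofRealCLM.hasDerivAt.mul_const _).const_add _
        rw [one_mul] at h0
        exact HasDerivAt.comp (h₂ := fun k => -abelInfty c a k⁻¹) t
          (hasDerivAt_neg_abelInfty_inv ha hac (hpath t ht)) h0
      have hint : IntervalIntegrable (fun t : ℝ => 1 / w c a ((c : ℂ) + t * (k - c)) * (k - c))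
          MeasureTheory.volume 0 1 := by
        refine ContinuousOn.intervalIntegrable ?_
        rw [uIcc_of_le zero_le_one]
        exact ((continuousOn_one_div_w ha hac).comp (by fun_prop)
          fun t ht => hpath t ht).mul continuousOn_const
      rw [segInt, intervalIntegral.integral_eq_sub_of_hasDerivAt hder hint]
      simp
    rw [hseg, ← hGL]; ring
  · rw [segInt_from_branch ha hac (z := k), mul_sub, hGL]
    rintro ⟨h1, h2⟩
    refine hk ((mem_cut_iff hc).2 ⟨h1, ?_, h2⟩)
    have := fun h' => h ⟨h1, h'⟩
    linarith [not_lt.1 this]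

end Abel

/-! ### The model solution and its expansion at infinity -/

section Expansion

open Complex Set Asymptotics

lemma taylor_isBigO {f : ℂ → ℂ} {x : ℂ} (hf : AnalyticAt ℂ f x) (n : ℕ) :
    (fun y : ℂ => f (x + y) - ∑ i ∈ Finset.range n, iteratedDeriv i f x / i.factorial * y ^ i)
      =O[𝓝 0] fun y => y ^ n := by
  have h := hf.hasFPowerSeriesAt.isBigO_sub_partialSum_pow n
  refine IsBigO.trans (h.congr_left fun y => ?_) (IsBigO.of_bound 1 ?_)
  · simp only [FormalMultilinearSeries.partialSum,
      FormalMultilinearSeries.apply_eq_pow_smul_coeff, FormalMultilinearSeries.coeff_ofScalars,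
      smul_eq_mul]
    simp only [mul_comm]
  · exact Eventually.of_forall fun y => by simp

/-- The cubic Taylor term cancels, which is why the error in the final expansion is `O(k⁻⁴)` and not
`O(k⁻³)`. -/
lemma second_difference_isBigO {f : ℂ → ℂ} {x : ℂ} (hf : AnalyticAt ℂ f x) :
    (fun y : ℂ => f (x + y) + f (x - y) - 2 * f x - iteratedDeriv 2 f x * y ^ 2)
      =O[𝓝 0] fun y => y ^ 4 := by
  have h := taylor_isBigO hf 4
  have hneg : Tendsto (fun y : ℂ => -y) (𝓝 0) (𝓝 0) := by
    simpa using (continuous_neg.tendsto (0 : ℂ))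
  refine (h.add ((h.comp_tendsto hneg).trans (IsBigO.of_bound 1 ?_))).congr_left fun y => ?_
  · exact Eventually.of_forall fun y => by simp
  · simp [Finset.sum_range_succ, Nat.factorial, iteratedDeriv_zero]
    ring_nf

lemma first_difference_isBigO {f : ℂ → ℂ} {x : ℂ} (hf : AnalyticAt ℂ f x) :
    (fun y : ℂ => f (x + y) - f (x - y) - 2 * deriv f x * y) =O[𝓝 0] fun y => y ^ 3 := by
  have h := taylor_isBigO hf 3
  have hneg : Tendsto (fun y : ℂ => -y) (𝓝 0) (𝓝 0) := by
    simpa using (continuous_neg.tendsto (0 : ℂ))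
  refine (h.sub ((h.comp_tendsto hneg).trans (IsBigO.of_bound 1 ?_))).congr_left fun y => ?_
  · exact Eventually.of_forall fun y => by simp
  · simp [Finset.sum_range_succ, Nat.factorial, iteratedDeriv_zero, iteratedDeriv_one]
    ring_nf

lemma pow_isBigO_pow {m n : ℕ} (h : n ≤ m) : (fun y : ℂ => y ^ m) =O[𝓝 0] fun y => y ^ n := by
  have : (fun y : ℂ => y ^ (m - n)) =O[𝓝 0] fun _ => (1 : ℂ) :=
    ((continuous_pow (m - n)).tendsto 0).isBigO_one ℂ
  refine (this.mul (isBigO_refl (fun y : ℂ => y ^ n) _)).congr (fun y => ?_) fun y => one_mul _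
  rw [← pow_add, Nat.sub_add_cancel h]

/-- Exponential of a function with an expansion in even powers. -/
lemma exp_isBigO {E : ℂ → ℂ} {κ : ℂ} (hE : (fun u => E u - κ * u ^ 2) =O[𝓝 0] fun u => u ^ 4) :
    (fun u => exp (E u) - (1 + κ * u ^ 2)) =O[𝓝 0] fun u => u ^ 4 := by
  have hE2 : E =O[𝓝 0] fun u => u ^ 2 := by
    have h1 := hE.trans (pow_isBigO_pow (by norm_num : 2 ≤ 4))
    exact (h1.add ((isBigO_refl (fun u : ℂ => u ^ 2) (𝓝 0)).const_mul_left κ)).congr_left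
      fun u => by ring
  have hE0 : Tendsto E (𝓝 0) (𝓝 0) := by
    refine hE2.trans_tendsto ?_
    simpa using (continuous_pow 2).tendsto (0 : ℂ)
  have hexp : (fun u => exp (E u) - 1 - E u) =O[𝓝 0] fun u => u ^ 4 := by
    have h1 : (fun u => exp (E u) - 1 - E u) =O[𝓝 0] fun u => E u ^ 2 := by
      refine IsBigO.of_bound 1 ?_
      filter_upwards [hE0.norm.eventually (ge_mem_nhds (by simp : ‖(0 : ℂ)‖ < 1))] with u hu
      have := Complex.exp_bound_sq 0 (E u) hu
      simpa using this
    refine h1.trans ((hE2.pow 2).congr_right fun u => ?_)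
    ring
  exact (hexp.add hE).congr_left fun u => by ring

variable {c a : ℝ}

/-- The factor `θ₃(1/2 | 2τ)` produced by `theta_mul_theta_half` depends on neither `k` nor `L` and
is nonzero, so it cancels. -/
lemma alphaHat_eq (ha : 0 < a) (hac : a < c) (L : ℝ) (k : ℂ) :
    alphaHat c a L k = jacobiTheta₂ (2 * abel c a k - 1 / 2 - L) (2 * tau c a) /
      jacobiTheta₂ (2 * abel c a k - 1 / 2) (2 * tau c a) := by
  have hτ := tau_im_pos ha hac
  have key : ∀ l : ℝ, alpha c a l k = jacobiTheta₂ (2 * abel c a k - 1 / 2 - l) (2 * tau c a) *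
      jacobiTheta₂ (1 / 2) (2 * tau c a) := fun l => by
    have := theta_mul_theta_half (abel c a k - l / 2) hτ
    rw [alpha, theta3, theta3, show abel c a k - 1 / 2 - (l : ℂ) / 2 = abel c a k - l / 2 - 1 / 2 by
      ring, this]
    congr 2; ring
  have h0 : jacobiTheta₂ (1 / 2) (2 * tau c a) ≠ 0 := by
    have h := theta_half_eq (periodRatio_modulus_pos ha hac)
    rw [two_tau_eq ha hac, h.1]
    exact_mod_cast h.2.ne'
  rw [alphaHat, key, key, mul_div_mul_right _ _ h0, ofReal_zero, sub_zero]

lemma betaHat_eq (ha : 0 < a) (hac : a < c) (L : ℝ) (k : ℂ) :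
    betaHat c a L k = jacobiTheta₂ (-(2 * abel c a k) + 1 / 2 - L) (2 * tau c a) /
      jacobiTheta₂ (2 * abel c a k - 1 / 2) (2 * tau c a) := by
  have hτ := tau_im_pos ha hac
  have key : ∀ l : ℝ, beta c a l k =
      jacobiTheta₂ (-(2 * abel c a k) + 1 / 2 - l) (2 * tau c a) *
      jacobiTheta₂ (1 / 2) (2 * tau c a) := fun l => by
    have := theta_mul_theta_half (-abel c a k - l / 2) hτ
    rw [beta, theta3, theta3, show -abel c a k - 1 / 2 - (l : ℂ) / 2 = -abel c a k - l / 2 - 1 / 2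
      by ring, this, ← jacobiTheta₂_add_left (2 * (-abel c a k - l / 2) - 1 / 2)]
    congr 2; ring
  have h0 : jacobiTheta₂ (1 / 2) (2 * tau c a) ≠ 0 := by
    have h := theta_half_eq (periodRatio_modulus_pos ha hac)
    rw [two_tau_eq ha hac, h.1]
    exact_mod_cast h.2.ne'
  rw [betaHat, key, key, mul_div_mul_right _ _ h0, ofReal_zero, sub_zero,
    ← jacobiTheta₂_neg_left (2 * abel c a k - 1 / 2)]
  congr 2; ring

lemma eventually_notMem_cut (c : ℝ) : ∀ᶠ k in Bornology.cobounded ℂ, k ∉ cut c := by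
  have hcomp : IsCompact (cut c) := by
    rw [cut, segment_eq_image]
    exact isCompact_Icc.image (by fun_prop)
  exact hcomp.isBounded

lemma zero_mem_slitDomain (c : ℝ) : (0 : ℂ) ∈ slitDomain c := by simp [slitDomain]

lemma tendsto_abel (ha : 0 < a) (hac : a < c) :
    Tendsto (abel c a) (Bornology.cobounded ℂ) (𝓝 (1 / 4)) := by
  have h0 : Tendsto (fun k : ℂ => abelInfty c a k⁻¹) (Bornology.cobounded ℂ)
      (𝓝 (abelInfty c a 0)) :=
    (hasDerivAt_abelInfty ha hac (zero_mem_slitDomain c)).continuousAt.tendsto.comp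
      tendsto_inv₀_cobounded
  have h1 := (h0.const_mul (Gam c a)).const_sub (1 / 4)
  have hz : abelInfty c a 0 = 0 := by simp [abelInfty]
  rw [hz, mul_zero, sub_zero] at h1
  refine h1.congr' ?_
  filter_upwards [eventually_notMem_cut c] with k hk using (abel_eq ha hac hk).symm

lemma two_tau_im_pos (ha : 0 < a) (hac : a < c) : 0 < (2 * tau c a).im := by
  simpa using tau_im_pos ha hac

lemma continuous_theta (ha : 0 < a) (hac : a < c) :
    Continuous fun z => jacobiTheta₂ z (2 * tau c a) :=
  continuous_iff_continuousAt.2 fun z =>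
    (differentiableAt_jacobiTheta₂_fst z (two_tau_im_pos ha hac)).continuousAt

lemma exists_pos_theta (ha : 0 < a) (hac : a < c) (x : ℝ) :
    ∃ r : ℝ, 0 < r ∧ jacobiTheta₂ x (2 * tau c a) = r := by
  rw [two_tau_eq ha hac]
  exact exists_pos_theta_real x (periodRatio_modulus_pos ha hac)

lemma theta_real_ne_zero (ha : 0 < a) (hac : a < c) (x : ℝ) :
    jacobiTheta₂ x (2 * tau c a) ≠ 0 := by
  obtain ⟨r, hr, h⟩ := exists_pos_theta ha hac x
  rw [h]; exact_mod_cast hr.ne'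

lemma theta_zero_ne_zero (ha : 0 < a) (hac : a < c) : jacobiTheta₂ 0 (2 * tau c a) ≠ 0 := by
  simpa using theta_real_ne_zero ha hac 0

/-- Common to `α̂` and `β̂`: `A(k) → 1/4` sends the denominator's argument to `0`, where `θ₃` does
not vanish. -/
lemma atInfty_theta_quotient (ha : 0 < a) (hac : a < c) {f : ℂ → ℂ} {L : ℝ} {g : ℂ → ℂ}
    (hg : Continuous g) (hgL : jacobiTheta₂ (g (1 / 4)) (2 * tau c a) =
      jacobiTheta₂ L (2 * tau c a))
    (hf : ∀ k, f k = jacobiTheta₂ (g (abel c a k)) (2 * tau c a) /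
      jacobiTheta₂ (2 * abel c a k - 1 / 2) (2 * tau c a)) :
    atInfty f = jacobiTheta₂ L (2 * tau c a) / jacobiTheta₂ 0 (2 * tau c a) := by
  have hA := tendsto_abel ha hac
  have hθ := continuous_theta ha hac
  refine Tendsto.limUnder_eq ?_
  have h1 := ((hθ.comp hg).tendsto (1 / 4)).comp hA
  have h2 := ((hθ.comp (by fun_prop : Continuous fun z : ℂ => 2 * z - 1 / 2)).tendsto
    (1 / 4)).comp hA
  simp only [Function.comp_def] at h1 h2
  norm_num at h2
  rw [hgL] at h1
  refine (h1.div h2 (theta_zero_ne_zero ha hac)).congr fun k => ?_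
  simp [hf]

lemma atInfty_alphaHat (ha : 0 < a) (hac : a < c) (L : ℝ) :
    atInfty (alphaHat c a L) =
      jacobiTheta₂ L (2 * tau c a) / jacobiTheta₂ 0 (2 * tau c a) := by
  refine atInfty_theta_quotient ha hac (g := fun z => 2 * z - 1 / 2 - L) (by fun_prop) ?_
    (alphaHat_eq ha hac L)
  rw [← jacobiTheta₂_neg_left]; congr 1; ring

lemma atInfty_betaHat (ha : 0 < a) (hac : a < c) (L : ℝ) :
    atInfty (betaHat c a L) =
      jacobiTheta₂ L (2 * tau c a) / jacobiTheta₂ 0 (2 * tau c a) := by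
  refine atInfty_theta_quotient ha hac (g := fun z => -(2 * z) + 1 / 2 - L) (by fun_prop) ?_
    (betaHat_eq ha hac L)
  rw [← jacobiTheta₂_neg_left]; congr 1; ring

lemma mMod_mul (ha : 0 < a) (hac : a < c) (Λ : ℝ) (k : ℂ) :
    mMod₁ c a Λ k * mMod₂ c a Λ k =
      gammaTilde c a k ^ 2 *
        ((theta3 (2 * abel c a k - 1 / 2 - ((Λ / (2 * Real.pi) : ℝ) : ℂ)) (2 * tau c a) *
          theta3 (-(2 * abel c a k) + 1 / 2 - ((Λ / (2 * Real.pi) : ℝ) : ℂ)) (2 * tau c a) *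
          theta3 0 (2 * tau c a) ^ 2) /
        (theta3 (2 * abel c a k - 1 / 2) (2 * tau c a) ^ 2 *
          theta3 ((Λ / (2 * Real.pi) : ℝ) : ℂ) (2 * tau c a) ^ 2)) := by
  rw [mMod₁, mMod₂, atInfty_alphaHat ha hac, atInfty_betaHat ha hac, alphaHat_eq ha hac,
    betaHat_eq ha hac]
  -- With `0⁻¹ = 0` this regrouping of inverses holds at every `k`, so no nonvanishing of `θ₃(2A -
  -- 1/2)` is needed.
  simp only [theta3, div_eq_mul_inv, mul_inv, inv_inv]
  ring

/-- The logarithm of the theta function at `2τ`. -/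
def logTheta (c a : ℝ) (v : ℂ) : ℂ := log (theta3 v (2 * tau c a))

lemma analyticAt_theta (ha : 0 < a) (hac : a < c) (x : ℂ) :
    AnalyticAt ℂ (fun v => theta3 v (2 * tau c a)) x :=
  Differentiable.analyticAt
    (fun z => differentiableAt_jacobiTheta₂_fst z (two_tau_im_pos ha hac)) x

lemma theta_real_mem_slitPlane (ha : 0 < a) (hac : a < c) (x : ℝ) :
    theta3 x (2 * tau c a) ∈ slitPlane := by
  obtain ⟨r, hr, h⟩ := exists_pos_theta ha hac x
  rw [theta3, h]
  exact ofReal_mem_slitPlane.2 hr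

lemma analyticAt_logTheta (ha : 0 < a) (hac : a < c) (x : ℝ) :
    AnalyticAt ℂ (logTheta c a) x :=
  (analyticAt_theta ha hac x).clog (theta_real_mem_slitPlane ha hac x)

/-- The derivative of `θ₃` is odd, so only `θ₃''(0)/θ₃(0)` survives in `(log θ₃)''(0)`; the heat
equation and `heat_theta_periodRatio` evaluate it. -/
lemma iteratedDeriv_two_logTheta_zero (ha : 0 < a) (hac : a < c) :
    iteratedDeriv 2 (logTheta c a) 0 =
      ((4 * eK ((a / c) ^ 2) * ((1 - (a / c) ^ 2) * eK ((a / c) ^ 2) - eE ((a / c) ^ 2)) : ℝ) : ℂ)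
      := by
  have hτ := two_tau_im_pos ha hac
  have h0 := theta_zero_ne_zero ha hac
  have hev : deriv (logTheta c a) =ᶠ[𝓝 0]
      fun v => jacobiTheta₂' v (2 * tau c a) / jacobiTheta₂ v (2 * tau c a) := by
    have : ∀ᶠ v in 𝓝 (0 : ℂ), jacobiTheta₂ v (2 * tau c a) ∈ slitPlane :=
      (continuous_theta ha hac).continuousAt.eventually (isOpen_slitPlane.mem_nhds (by
        simpa [theta3] using theta_real_mem_slitPlane ha hac 0))
    filter_upwards [this] with v hv
    exact ((hasDerivAt_jacobiTheta₂_fst v hτ).clog hv).deriv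
  have hodd : jacobiTheta₂' 0 (2 * tau c a) = 0 := by
    have := jacobiTheta₂'_neg_left 0 (2 * tau c a)
    rw [neg_zero] at this
    linear_combination this / 2
  rw [iteratedDeriv_succ, iteratedDeriv_one, hev.deriv_eq,
    ((hasDerivAt_jacobiTheta₂' 0 hτ).fun_div (hasDerivAt_jacobiTheta₂_fst 0 hτ) h0).deriv, hodd]
  have hheat := heat_theta_periodRatio (div_sq_pos ha hac) (div_sq_lt_one ha hac)
  rw [← two_tau_eq ha hac] at hheat
  rw [hheat]
  field_simp
  ring

lemma theta_exp_log (ha : 0 < a) (hac : a < c) (x : ℝ) : ∀ᶠ y in 𝓝 (0 : ℂ),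
    theta3 (x + y) (2 * tau c a) * theta3 (x - y) (2 * tau c a) =
      exp (logTheta c a (x + y) + logTheta c a (x - y) - 2 * logTheta c a x) *
        theta3 x (2 * tau c a) ^ 2 := by
  have hx := theta_real_ne_zero ha hac x
  have h1 : ∀ᶠ y in 𝓝 (0 : ℂ), theta3 (x + y) (2 * tau c a) ≠ 0 :=
    ((continuous_theta ha hac).comp (continuous_const_add (x : ℂ))).continuousAt.eventually_ne
      (by simpa using hx)
  have h2 : ∀ᶠ y in 𝓝 (0 : ℂ), theta3 (x - y) (2 * tau c a) ≠ 0 :=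
    ((continuous_theta ha hac).comp (continuous_const.sub continuous_id)
      ).continuousAt.eventually_ne (by simpa using hx)
  filter_upwards [h1, h2] with y hy1 hy2
  have hx' : theta3 x (2 * tau c a) ≠ 0 := hx
  rw [exp_sub, exp_add, two_mul (logTheta c a x), exp_add]
  simp only [logTheta, exp_log hy1, exp_log hy2, exp_log hx']
  field_simp

/-- Oddness removes the quadratic term. -/
lemma abelInfty_isBigO (ha : 0 < a) (hac : a < c) :
    (fun u : ℂ => abelInfty c a u - u) =O[𝓝 0] fun u => u ^ 3 := by
  have hmem := zero_mem_slitDomain c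
  have han : AnalyticAt ℂ (abelInfty c a) 0 :=
    (DifferentiableOn.analyticAt (s := slitDomain c)
      (fun u hu => (hasDerivAt_abelInfty ha hac hu).differentiableAt.differentiableWithinAt)
      ((isOpen_slitDomain c).mem_nhds hmem))
  have hodd : ∀ u, abelInfty c a (-u) = -abelInfty c a u := fun u => by
    simp only [abelInfty, formAtInfty, mul_neg, neg_sq, neg_mul, intervalIntegral.integral_neg]
  have hder : deriv (abelInfty c a) 0 = 1 := by
    rw [(hasDerivAt_abelInfty ha hac hmem).deriv]
    simp [formAtInfty, csqrt]
  refine ((first_difference_isBigO han).const_mul_left (1 / 2)).congr_left fun u => ?_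
  rw [zero_add, zero_sub, hodd, hder]
  ring

/-- The logarithm of `γ̃²` in the variable `1 / k²`. -/
def logGammaSq (c a : ℝ) (s : ℂ) : ℂ :=
  log ((1 + (a : ℂ) ^ 2 * s) / (1 + (c : ℂ) ^ 2 * s)) / 2

lemma logGammaSq_isBigO (c a : ℝ) :
    (fun u : ℂ => logGammaSq c a (u ^ 2) - ((a : ℂ) ^ 2 - c ^ 2) / 2 * u ^ 2) =O[𝓝 0]
      fun u => u ^ 4 := by
  have h1 : HasDerivAt (fun s : ℂ => (1 + (a : ℂ) ^ 2 * s) / (1 + (c : ℂ) ^ 2 * s))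
      ((a : ℂ) ^ 2 - c ^ 2) 0 := by
    have hd (b : ℂ) : HasDerivAt (fun s : ℂ => 1 + b * s) b 0 := by
      simpa using ((hasDerivAt_id (0 : ℂ)).const_mul b).const_add 1
    refine ((hd _).fun_div (hd _) (by simp)).congr_deriv ?_
    simp
  have h2 : HasDerivAt (logGammaSq c a) (((a : ℂ) ^ 2 - c ^ 2) / 2) 0 := by
    refine ((h1.clog (by simp)).div_const 2).congr_deriv ?_
    simp
  have han : AnalyticAt ℂ (logGammaSq c a) 0 := by
    refine AnalyticAt.div (AnalyticAt.clog (AnalyticAt.div (by fun_prop) (by fun_prop) (by simp))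
      (by simp)) analyticAt_const two_ne_zero
  have h := taylor_isBigO han 2
  have hsq : Tendsto (fun u : ℂ => u ^ 2) (𝓝 0) (𝓝 0) := by
    simpa using (continuous_pow 2).tendsto (0 : ℂ)
  refine (h.comp_tendsto hsq).congr (fun u => ?_) fun u => ?_
  · simp [Finset.sum_range_succ, iteratedDeriv_zero, iteratedDeriv_one, h2.deriv, logGammaSq]
  · simp only [Function.comp]; ring

lemma gammaTilde_sq (ha : 0 < a) (hac : a < c) {k : ℂ} (hk : k ∉ cut c) :
    gammaTilde c a k ^ 2 = exp (logGammaSq c a (k⁻¹ ^ 2)) := by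
  have hc := ha.trans hac
  have h0 := ne_zero_of_notMem_cut hc hk
  have hm := inv_mem_slitDomain hc hk
  have h1 : 1 + (c : ℂ) ^ 2 * k⁻¹ ^ 2 ≠ 0 := slitPlane_ne_zero hm
  have h2 : 1 + (a : ℂ) ^ 2 * k⁻¹ ^ 2 ≠ 0 := slitPlane_ne_zero (slitDomain_scale ha.le hac.le hm)
  have e : (k ^ 2 + (a : ℂ) ^ 2) / (k ^ 2 + (c : ℂ) ^ 2) =
      (1 + (a : ℂ) ^ 2 * k⁻¹ ^ 2) / (1 + (c : ℂ) ^ 2 * k⁻¹ ^ 2) := by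
    have e1 (b : ℂ) : k ^ 2 + b = k ^ 2 * (1 + b * k⁻¹ ^ 2) := by field_simp
    rw [e1, e1, mul_div_mul_left _ _ (pow_ne_zero 2 h0)]
  rw [gammaTilde, e, cpow_def_of_ne_zero (div_ne_zero h2 h1), ← exp_nat_mul, logGammaSq]
  congr 1; push_cast; ring

/-- The logarithm of the product of the components of the model solution near infinity. -/
def logProduct (c a L : ℝ) (u : ℂ) : ℂ :=
  logGammaSq c a (u ^ 2) +
    ((logTheta c a (L + -2 * Gam c a * abelInfty c a u) +
        logTheta c a (L - -2 * Gam c a * abelInfty c a u) - 2 * logTheta c a L) -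
      (logTheta c a (0 + -2 * Gam c a * abelInfty c a u) +
        logTheta c a (0 - -2 * Gam c a * abelInfty c a u) - 2 * logTheta c a 0))

lemma tendsto_abelInfty_zero (ha : 0 < a) (hac : a < c) :
    Tendsto (fun u => -2 * Gam c a * abelInfty c a u) (𝓝 0) (𝓝 0) := by
  have h := ((hasDerivAt_abelInfty ha hac (zero_mem_slitDomain c)).continuousAt.tendsto).const_mul
    (-2 * Gam c a)
  have hz : abelInfty c a 0 = 0 := by simp [abelInfty]
  rwa [hz, mul_zero] at h

lemma logProduct_isBigO (ha : 0 < a) (hac : a < c) (L : ℝ) :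
    (fun u => logProduct c a L u - (1 / 2 * (8 * Gam c a ^ 2 * iteratedDeriv 2 (logTheta c a) L +
      Qconst c a)) * u ^ 2) =O[𝓝 0] fun u => u ^ 4 := by
  have hF := abelInfty_isBigO ha hac
  have hδ := tendsto_abelInfty_zero ha hac
  have hF1 : abelInfty c a =O[𝓝 0] fun u : ℂ => u := by
    have h1 : (fun u : ℂ => abelInfty c a u - u) =O[𝓝 0] fun u => u :=
      (hF.trans (pow_isBigO_pow (by norm_num : 1 ≤ 3))).congr_right fun u => pow_one u
    exact (h1.add (isBigO_refl (fun u : ℂ => u) (𝓝 0))).congr_left fun u => by ring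
  have hF2 : (fun u : ℂ => abelInfty c a u ^ 2 - u ^ 2) =O[𝓝 0] fun u => u ^ 4 :=
    (hF.mul (hF1.add (isBigO_refl (fun u : ℂ => u) (𝓝 0)))).congr (fun u => by ring)
      fun u => by ring
  have hδ4 : (fun u : ℂ => (-2 * Gam c a * abelInfty c a u) ^ 4) =O[𝓝 0] fun u => u ^ 4 :=
    (hF1.const_mul_left (-2 * Gam c a)).pow 4
  have hφ (x : ℝ) := ((second_difference_isBigO (analyticAt_logTheta ha hac x)).comp_tendsto
    hδ).trans hδ4
  have hφL := hφ L
  have hφ0 := hφ 0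
  rw [ofReal_zero] at hφ0
  -- The origin of `Q`: `a² - c²` comes from `γ̃²`, the rest from the denominator `θ₃(2A - 1/2)²`.
  -- Inserting `Γ² = -c²/(16K²)` produces the ratio `E/K`.
  have hQ : (Qconst c a : ℂ) =
      (a : ℂ) ^ 2 - c ^ 2 - 8 * Gam c a ^ 2 * iteratedDeriv 2 (logTheta c a) 0 := by
    rw [iteratedDeriv_two_logTheta_zero ha hac, Gam_eq ha hac, Qconst]
    change ((-a ^ 2 + c ^ 2 * (1 - 2 * (eE ((a / c) ^ 2) / eK ((a / c) ^ 2))) : ℝ) : ℂ) = _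
    have h1 := eK_ne_zero ha hac
    have h2 : (c : ℂ) ≠ 0 := by exact_mod_cast (ha.trans hac).ne'
    push_cast
    generalize (eK ((a / c) ^ 2) : ℂ) = K at *
    generalize (eE ((a / c) ^ 2) : ℂ) = E at *
    rw [div_pow, mul_pow, I_sq]
    field_simp
    ring
  refine (((logGammaSq_isBigO c a).add (hφL.sub hφ0)).add (hF2.const_mul_left
    (4 * Gam c a ^ 2 * (iteratedDeriv 2 (logTheta c a) L -
      iteratedDeriv 2 (logTheta c a) 0)))).congr_left fun u => ?_
  simp only [Function.comp, logProduct, hQ]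
  ring

/-- With `2A - 1/2 = δ`, evenness turns numerator and denominator into products `θ₃(x + δ) θ₃(x -
δ)` at `x = Λ̃` and `x = 0`, which `theta_exp_log` writes as exponentials. -/
lemma mMod_mul_eventually (ha : 0 < a) (hac : a < c) (Λ : ℝ) :
    ∀ᶠ k in Bornology.cobounded ℂ, mMod₁ c a Λ k * mMod₂ c a Λ k =
      exp (logProduct c a (Λ / (2 * Real.pi)) k⁻¹) := by
  have hδ := (tendsto_abelInfty_zero ha hac).comp (tendsto_inv₀_cobounded (α := ℂ))
  have h0 := theta_exp_log ha hac 0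
  rw [ofReal_zero] at h0
  filter_upwards [eventually_notMem_cut c, hδ.eventually (theta_exp_log ha hac (Λ / (2 * Real.pi))),
    hδ.eventually h0] with k hk hL hZ
  simp only [Function.comp_apply] at hL hZ
  rw [mMod_mul ha hac, gammaTilde_sq ha hac hk, logProduct, exp_add, exp_sub]
  have hA := abel_eq ha hac hk
  set L : ℝ := Λ / (2 * Real.pi)
  set δ := -2 * Gam c a * abelInfty c a k⁻¹ with hδdef
  have e1 : theta3 (2 * abel c a k - 1 / 2 - L) (2 * tau c a) = theta3 (L - δ) (2 * tau c a) := by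
    rw [theta3, theta3, ← jacobiTheta₂_neg_left]; congr 1; rw [hA, hδdef]; ring
  have e2 : theta3 (-(2 * abel c a k) + 1 / 2 - L) (2 * tau c a) =
      theta3 (L + δ) (2 * tau c a) := by
    rw [theta3, theta3, ← jacobiTheta₂_neg_left]; congr 1; rw [hA, hδdef]; ring
  have e3 : theta3 (2 * abel c a k - 1 / 2) (2 * tau c a) = theta3 (0 + δ) (2 * tau c a) := by
    congr 1; rw [hA, hδdef]; ring
  have e4 : theta3 (0 - δ) (2 * tau c a) = theta3 (0 + δ) (2 * tau c a) := by
    rw [theta3, theta3, ← jacobiTheta₂_neg_left]; congr 1; ring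
  have hθL : theta3 L (2 * tau c a) ≠ 0 := theta_real_ne_zero ha hac L
  have hθ0 : theta3 0 (2 * tau c a) ≠ 0 := theta_zero_ne_zero ha hac
  rw [e4] at hZ
  rw [e1, e2, e3, mul_comm (theta3 (L - δ) _), hL, sq (theta3 (0 + δ) _), hZ]
  have hexp := exp_ne_zero (logTheta c a (0 + δ) + logTheta c a (0 - δ) - 2 * logTheta c a 0)
  field_simp

end Expansion

end ModelRH

end

theorem lemma4p1 (c a Λ : ℝ) (ha : 0 < a) (hac : a < c) :
    (∀ k : ℂ, k ∉ ModelRH.cut c →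
      ModelRH.mMod₁ c a Λ k * ModelRH.mMod₂ c a Λ k =
        ModelRH.gammaTilde c a k ^ 2 *
          ((ModelRH.theta3 (2 * ModelRH.abel c a k - 1 / 2 - ((Λ / (2 * Real.pi) : ℝ) : ℂ))
                (2 * ModelRH.tau c a) *
              ModelRH.theta3 (-(2 * ModelRH.abel c a k) + 1 / 2 - ((Λ / (2 * Real.pi) : ℝ) : ℂ))
                (2 * ModelRH.tau c a) *
              ModelRH.theta3 0 (2 * ModelRH.tau c a) ^ 2) /
            (ModelRH.theta3 (2 * ModelRH.abel c a k - 1 / 2) (2 * ModelRH.tau c a) ^ 2 *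
              ModelRH.theta3 ((Λ / (2 * Real.pi) : ℝ) : ℂ) (2 * ModelRH.tau c a) ^ 2))) ∧
    Asymptotics.IsBigO (Bornology.cobounded ℂ)
      (fun k : ℂ => ModelRH.mMod₁ c a Λ k * ModelRH.mMod₂ c a Λ k -
        (1 + 1 / (2 * k ^ 2) *
          (8 * ModelRH.Gam c a ^ 2 *
              iteratedDeriv 2
                (fun v : ℂ => Complex.log (ModelRH.theta3 v (2 * ModelRH.tau c a)))
                ((Λ / (2 * Real.pi) : ℝ) : ℂ) +
            (ModelRH.Qconst c a : ℂ))))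
      (fun k : ℂ => 1 / k ^ 4) := by
  have hb := (ModelRH.exp_isBigO (ModelRH.logProduct_isBigO ha hac
    (Λ / (2 * Real.pi)))).comp_tendsto (Filter.tendsto_inv₀_cobounded (α := ℂ))
  refine ⟨fun k _ => ModelRH.mMod_mul ha hac Λ k, hb.congr' ?_ ?_⟩
  · filter_upwards [ModelRH.mMod_mul_eventually ha hac Λ] with k hk
    have hlog : (fun v : ℂ => Complex.log (ModelRH.theta3 v (2 * ModelRH.tau c a))) =
        ModelRH.logTheta c a := rfl
    rw [hk, hlog]
    simp only [Function.comp_apply]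
    ring
  · refine Filter.Eventually.of_forall fun k => ?_
    simp
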